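/- All Hilbert spaces are finite-dimensional, all alphabets are finite, and $\log$ is to base $2$, with $-\log 0=+\infty$. A cq-state is a density operator of the form $\rho_{XE}=\sum_x P_X(x)\,|x\rangle\langle x|\otimes\rho_E^x$, where $P_X$ is a probability distribution and the $\rho_E^x$ are density operators. For positive semidefinite $\rho_{AB}$ let $$H_\infty(A|B)_\rho=-\log\min\{\operatorname{Tr}\sigma_B:\ \sigma_B\ge 0,\ \rho_{AB}\le \mathrm{id}_A\otimes\sigma_B\},$$ and for $\varepsilon\ge 0$ and a state $\rho_{AB}$ let $$H_\infty^{\varepsilon}(A|B)_\rho=\sup\{H_\infty(A|B)_{\hat\rho}:\ \hat\rho_{AB}\ge 0,\ \operatorname{Tr}\hat\rho_{AB}\le 1,\ C(\rho_{AB},\hat\rho_{AB})\le\varepsilon\},$$ where $C(\rho,\sigma)=\sqrt{1-F(\rho,\sigma)^2}$, $F(\rho,\sigma)=\|\sqrt\rho\sqrt\sigma\|_1$, and $\|A\|_1=\operatorname{Tr}\sqrt{A^\dagger A}$. **Lemma.** Let $\varepsilon\ge 0$, $m\ge 1$ and $\alpha\in\mathbb R$. Let $\rho_{XE}=\bigotimes_{i=1}^{m}\rho_{X_iE_i}$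 be a product of $m$ cq-states, where $X=(X_1,\dots,X_m)$ and $E=(E_1,\dots,E_m)$, such that $H_\infty^{\varepsilon^2}(X_iX_j|E)_\rho\ge\alpha$ for all $i\ne j$. Then there is a random variable $V$ with values in $\{1,\dots,m\}$, that is, a state $\rho_{XVE}$ in which $X$ and $V$ are classical and whose reduced state on $XE$ is $\rho_{XE}$, such that for every $v\in\{1,\dots,m\}$ with $P[V\ne v]>0$ $$H_\infty^{\varepsilon}(X_v\,|\,E_vV,\ V\ne v)\ \ge\ \frac{\alpha}{2}-\log m ,$$ where the entropy on the left is that of the reduced state on $X_vE_vV$ of the normalized state $\rho_{XVE}$ conditioned on the event $V\ne v$. -/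

import Mathlib

open scoped ComplexOrder MatrixOrder Kronecker

noncomputable section

namespace QInfo

open Matrix

/-! Finite-dimensional Hilbert spaces are presented through an orthonormal basis indexed by a
finite type, so an operator on the space with basis `n` is a matrix in `Matrix n n ℂ`, and the
tensor product of the spaces with bases `a` and `b` has basis `a × b`. -/

/-- A quantum state: a positive semidefinite operator of trace one. -/
def IsState {n : Type*} [Fintype n] (ρ : Matrix n n ℂ) : Prop :=
  ρ.PosSemidef ∧ ρ.trace = 1

/-- A cq-state `ρ_{XE} = ∑ₓ P_X(x) |x⟩⟨x| ⊗ ρ_E^x`, with `P_X` a probability distribution on the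
finite alphabet `X` and every `ρ_E^x` a quantum state. -/
def IsCQState {X E : Type*} [Fintype X] [DecidableEq X] [Fintype E]
    (ρ : Matrix (X × E) (X × E) ℂ) : Prop :=
  ∃ (P : X → ℝ) (ρE : X → Matrix E E ℂ),
    (∀ x, 0 ≤ P x) ∧ ∑ x, P x = 1 ∧ (∀ x, IsState (ρE x)) ∧
      ρ = ∑ x, (P x : ℂ) • (Matrix.single x x (1 : ℂ) ⊗ₖ ρE x)

/-- The trace norm `‖A‖₁ = Tr √(A† A)`. -/
def traceNorm {n : Type*} [Fintype n] [DecidableEq n] (A : Matrix n n ℂ) : ℝ :=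
  (CFC.sqrt (Aᴴ * A)).trace.re

/-- The fidelity `F(ρ, σ) = ‖√ρ √σ‖₁`. -/
def fidelity {n : Type*} [Fintype n] [DecidableEq n] (ρ σ : Matrix n n ℂ) : ℝ :=
  traceNorm (CFC.sqrt ρ * CFC.sqrt σ)

/-- The distance `C(ρ, σ) = √(1 - F(ρ, σ)²)`. -/
def cDist {n : Type*} [Fintype n] [DecidableEq n] (ρ σ : Matrix n n ℂ) : ℝ :=
  Real.sqrt (1 - fidelity ρ σ ^ 2)

/-- The logarithm to base two of a nonnegative real, with `log 0 = -∞`. -/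
def log2 (t : ℝ) : EReal :=
  if t ≤ 0 then ⊥ else ((Real.logb 2 t : ℝ) : EReal)

/-- The conditional min-entropy
`H_∞(A|B)_ρ = - log min {Tr σ_B | σ_B ≥ 0, ρ_{AB} ≤ id_A ⊗ σ_B}`. -/
def minEntropy {a b : Type*} [Fintype a] [DecidableEq a] [Fintype b]
    (ρ : Matrix (a × b) (a × b) ℂ) : EReal :=
  -log2 (sInf {t : ℝ | ∃ σ : Matrix b b ℂ, σ.PosSemidef ∧
    ((1 : Matrix a a ℂ) ⊗ₖ σ - ρ).PosSemidef ∧ t = σ.trace.re})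

/-- The ball `K^ε(ρ)` of subnormalized positive semidefinite operators within `C`-distance `ε`. -/
def smoothBall {n : Type*} [Fintype n] [DecidableEq n] (ε : ℝ) (ρ : Matrix n n ℂ) :
    Set (Matrix n n ℂ) :=
  {τ | τ.PosSemidef ∧ cDist ρ τ ≤ ε ∧ τ.trace.re ≤ 1}

/-- The conditional `ε`-smooth min-entropy `H_∞^ε(A|B)_ρ = sup {H_∞(A|B)_τ | τ ∈ K^ε(ρ)}`. -/
def smoothMinEntropy {a b : Type*} [Fintype a] [DecidableEq a] [Fintype b] [DecidableEq b]
    (ε : ℝ) (ρ : Matrix (a × b) (a × b) ℂ) : EReal :=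
  ⨆ τ ∈ smoothBall ε ρ, minEntropy τ

/-- The partial trace, for a system with basis `n` that is identified with the composite of
subsystems with bases `a` and `b` through the bijection `p ↦ (keep p, discard p)`:
the subsystem `b` is traced out. -/
def partialTrace {n a b : Type*} [Fintype n] [DecidableEq a] [DecidableEq b]
    (keep : n → a) (discard : n → b) (M : Matrix n n ℂ) : Matrix a a ℂ :=
  Matrix.of fun s t => ∑ p, ∑ q,
    if keep p = s ∧ keep q = t ∧ discard p = discard q then M p q else 0

/-- On a product basis this is the usual partial trace over the second factor. -/
theorem partialTrace_fst_snd {a b : Type*} [Fintype a] [DecidableEq a] [Fintype b]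
    [DecidableEq b] (M : Matrix (a × b) (a × b) ℂ) (s t : a) :
    partialTrace Prod.fst Prod.snd M s t = ∑ y, M (s, y) (t, y) := by
  simp [partialTrace, Fintype.sum_prod_type, ite_and, Finset.sum_ite_irrel]

section Registers

variable {m : ℕ} {X E : Fin m → Type*}

/-- The product state `⨂ᵢ ρ_{XᵢEᵢ}`, with all `X`-registers listed before all `E`-registers. -/
def productState (ρ : ∀ i, Matrix (X i × E i) (X i × E i) ℂ) :
    Matrix ((∀ i, X i) × (∀ i, E i)) ((∀ i, X i) × (∀ i, E i)) ℂ :=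
  Matrix.of fun p q => ∏ i, ρ i (p.1 i, p.2 i) (q.1 i, q.2 i)

variable [∀ i, Fintype (X i)] [∀ i, DecidableEq (X i)] [∀ i, Fintype (E i)]
  [∀ i, DecidableEq (E i)]

/-- The reduced state on `Xᵢ Xⱼ E`, where `i ≠ j` and `E` consists of all registers `E₀, …`. -/
def pairState (ρ : Matrix ((∀ k, X k) × (∀ k, E k)) ((∀ k, X k) × (∀ k, E k)) ℂ)
    (i j : Fin m) :
    Matrix ((X i × X j) × (∀ k, E k)) ((X i × X j) × (∀ k, E k)) ℂ :=
  partialTrace (fun p => ((p.1 i, p.1 j), p.2))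
    (fun p => fun k : {k : Fin m // k ≠ i ∧ k ≠ j} => p.1 k) ρ

/-- The reduced state on `X E` of a state on `X V E`. -/
def forgetV (τ : Matrix (((∀ k, X k) × Fin m) × (∀ k, E k))
      (((∀ k, X k) × Fin m) × (∀ k, E k)) ℂ) :
    Matrix ((∀ k, X k) × (∀ k, E k)) ((∀ k, X k) × (∀ k, E k)) ℂ :=
  partialTrace (fun p => (p.1.1, p.2)) (fun p => p.1.2) τ

/-- The reduced state on `X_v E_v V` of a state on `X V E`, with `X_v` as first subsystem. -/
def localState (τ : Matrix (((∀ k, X k) × Fin m) × (∀ k, E k))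
      (((∀ k, X k) × Fin m) × (∀ k, E k)) ℂ) (v : Fin m) :
    Matrix (X v × (E v × Fin m)) (X v × (E v × Fin m)) ℂ :=
  partialTrace (fun p => (p.1.1 v, (p.2 v, p.1.2)))
    (fun p => ((fun k : {k : Fin m // k ≠ v} => p.1.1 k),
      (fun k : {k : Fin m // k ≠ v} => p.2 k))) τ

/-- The probability `P[V ≠ v]` for the classical register `V`. -/
def probNe (τ : Matrix (((∀ k, X k) × Fin m) × (∀ k, E k))
      (((∀ k, X k) × Fin m) × (∀ k, E k)) ℂ) (v : Fin m) : ℝ :=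
  ∑ p, if p.1.2 ≠ v then (τ p p).re else 0

/-- The normalized state of `X V E` conditioned on the event `V ≠ v`. -/
def condNe (τ : Matrix (((∀ k, X k) × Fin m) × (∀ k, E k))
      (((∀ k, X k) × Fin m) × (∀ k, E k)) ℂ) (v : Fin m) :
    Matrix (((∀ k, X k) × Fin m) × (∀ k, E k)) (((∀ k, X k) × Fin m) × (∀ k, E k)) ℂ :=
  Matrix.of fun p q =>
    if p.1.2 ≠ v ∧ q.1.2 ≠ v then ((probNe τ v)⁻¹ : ℂ) * τ p q else 0

end Registers

end QInfo

end

namespace QInfo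
open Matrix

/-! The variable `V` can be deterministic. With `V = v₀` nothing is claimed about `v₀`, and for `v ≠
v₀` conditioning on `V ≠ v` changes nothing, so the local state is `ρ v` with a constant register
attached. It therefore suffices that at most one index lacks a state `ε`-close to `ρ v` and
dominated by `1 ⊗ ω` with `Tr ω ≤ c = m * 2 ^ (-(α / 2))`.

The largest fidelity of `ρ v` to such dominated states is a semidefinite program. If it stays below
`h = √(1 - ε²)`, convex separation yields a dual witness `W ≥ 0` with marginal at most `μ`, and a
shift `s > 0`, such that `Tr ρ(s + W)⁻¹ + s + cμ < 2h` (`exists_purification_or_dual`). This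
certifies the failure through the bound `F(ρ, τ)² ≤ Tr(ρZ⁻¹) Tr(τZ)`, applied with `Z = s + W`.

Suppose two indices fail. Their witnesses are multiplied: for the pair one takes `Z = (1 + 3R W ⊗
W') / (1 + R)`, with `W` and `W'` normalized by `cμ` and `c'μ'`. Marginal bounds multiply, so
`Tr(τZ) ≤ 1` for every subnormalized `τ` dominated by `1 ⊗ σ` with `3 Tr σ ≤ cc'`. Here `W ⊗ W'` is
diagonal in a product basis and the state is a product, so `Tr(ρZ⁻¹)` is an average over two
independent distributions. The scalar inequality `exists_average_inv_le` supplies an `R` for which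
it is at most `1 - (1 - f)(1 - f')`, where `f, f' < 1 - ε²` are the individual values. Hence `F² < 1
- ε⁴` for the pair, contradicting its smoothing radius `ε²`. Two failing indices force `m ≥ 2`, and
`m² ≥ 4 > 3` pays for the factor 3. -/

/-! ### Scalar inequality for multiplying certificates -/

/-- The right side is the average for mass `A` at `x = 0` and mass `1 - A` at `x = 1`. For `y ≥ r`
the term `A` alone suffices; for `y < r` the bound is Jensen's inequality in the variable `(1 + r
x)⁻¹`. -/
theorem average_inv_one_add_mul_le {κ : Type*} [Fintype κ] (p x : κ → ℝ) (hp : ∀ k, 0 ≤ p k)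
    (hp1 : ∑ k, p k = 1) (hx : ∀ k, 0 ≤ x k) {r y A : ℝ} (hr : 0 < r) (hy : 0 ≤ y)
    (hA : A = ∑ k, p k * (1 + r * x k)⁻¹) (hA1 : (1 + r) * A ≤ 1) :
    ∑ k, p k * (1 + x k * y)⁻¹ ≤ A + (1 - A) * (1 + y)⁻¹ := by
  have ha : ∀ k, 0 < (1 + r * x k)⁻¹ := fun k => by
    have := hx k; positivity
  have hA0 : 0 < A := by
    have h : ∃ k ∈ Finset.univ, 0 < p k := by
      by_contra! h
      have : ∑ k, p k ≤ 0 := Finset.sum_nonpos h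
      linarith
    obtain ⟨k, -, hk⟩ := h
    rw [hA]
    exact Finset.sum_pos' (fun k _ => mul_nonneg (hp k) (ha k).le)
      ⟨k, Finset.mem_univ k, mul_pos hk (ha k)⟩
  have hA1' : A < 1 := by nlinarith
  rcases le_or_gt r y with hry | hry
  · calc ∑ k, p k * (1 + x k * y)⁻¹ ≤ A := by
          rw [hA]
          refine Finset.sum_le_sum fun k _ => mul_le_mul_of_nonneg_left ?_ (hp k)
          have := hx k
          apply inv_anti₀ (by positivity)
          nlinarith
      _ ≤ _ := by
          have : 0 < (1 + y)⁻¹ := by positivity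
          nlinarith
  · set D := A * r + (1 - A) * y with hD
    have hDpos : 0 < D := by
      have := mul_pos hA0 hr
      have := mul_nonneg (sub_nonneg.2 hA1'.le) hy
      linarith
    -- As a function of `a = (1 + r x)⁻¹`, the quantity `(1 + x y)⁻¹` equals `a r / (a r + (1 - a)
    -- y)`, which is concave for `y < r`; this is its tangent line at the mean `A`.
    have key : ∀ k, (1 + x k * y)⁻¹ ≤ A * r / D + r * y / D ^ 2 * ((1 + r * x k)⁻¹ - A) := by
      intro k
      have hxk := hx k
      set a := (1 + r * x k)⁻¹ with hadef
      have hapos := ha k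
      have hd : 0 < 1 + r * x k := by positivity
      have ha1 : a * (1 + r * x k) = 1 := inv_mul_cancel₀ hd.ne'
      have hle1 : a ≤ 1 := by nlinarith [mul_nonneg hr.le hxk]
      have hDa : 0 < a * r + (1 - a) * y := by
        have := mul_pos hapos hr
        have := mul_nonneg (sub_nonneg.2 hle1) hy
        linarith
      have e : (1 + x k * y)⁻¹ = a * r / (a * r + (1 - a) * y) := by
        rw [eq_div_iff hDa.ne', inv_mul_eq_iff_eq_mul₀ (by positivity)]
        have : 1 - a = a * r * x k := by linarith
        rw [this]; ring
      rw [e]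
      have : A * r / D + r * y / D ^ 2 * (a - A) - a * r / (a * r + (1 - a) * y)
          = r * y * (r - y) * (a - A) ^ 2 / (D ^ 2 * (a * r + (1 - a) * y)) := by
        generalize hE : a * r + (1 - a) * y = E at hDa ⊢
        field_simp
        rw [hD, ← hE]; ring
      have h2 : 0 ≤ r * y * (r - y) * (a - A) ^ 2 / (D ^ 2 * (a * r + (1 - a) * y)) := by
        have := sub_pos.2 hry
        positivity
      linarith
    calc ∑ k, p k * (1 + x k * y)⁻¹
        ≤ ∑ k, p k * (A * r / D + r * y / D ^ 2 * ((1 + r * x k)⁻¹ - A)) :=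
          Finset.sum_le_sum fun k _ => mul_le_mul_of_nonneg_left (key k) (hp k)
      _ = A * r / D := by
          have : ∀ k, p k * (A * r / D + r * y / D ^ 2 * ((1 + r * x k)⁻¹ - A))
              = p k * (A * r / D - r * y / D ^ 2 * A)
                + r * y / D ^ 2 * (p k * (1 + r * x k)⁻¹) := fun k => by ring
          simp_rw [this]
          rw [Finset.sum_add_distrib, ← Finset.sum_mul, ← Finset.mul_sum, hp1, ← hA]
          ring
      _ ≤ (1 + A * y) / (1 + y) := by
          rw [div_le_div_iff₀ hDpos (by positivity), hD]
          have h1 : A * r ≤ 1 + A * y := by nlinarith [mul_nonneg hA0.le hy]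
          have h2 : 0 ≤ (1 - A) * y * (1 + A * y - A * r) :=
            mul_nonneg (mul_nonneg (sub_nonneg.2 hA1'.le) hy) (by linarith)
          nlinarith
      _ = _ := by field_simp; ring

/-- The average is bounded by `A + B - A * B`, the value obtained by replacing the product `x y` by
a logical "and". The slack between `(1 + R)(A + B - AB)` and the target then limits the size of `R`,
with two regimes according to whether `r ≤ 1`. -/
theorem exists_average_inv_le_of_le {κ ι : Type*} [Fintype κ] [Fintype ι] (p x : κ → ℝ)
    (q y : ι → ℝ) (hp : ∀ k, 0 ≤ p k) (hq : ∀ l, 0 ≤ q l) (hp1 : ∑ k, p k = 1)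
    (hq1 : ∑ l, q l = 1) (hx : ∀ k, 0 ≤ x k) (hy : ∀ l, 0 ≤ y l) {r s A B : ℝ}
    (hs : 0 < s) (hsr : s ≤ r)
    (hA : A = ∑ k, p k * (1 + r * x k)⁻¹) (hA1 : (1 + r) * A ≤ 1)
    (hB : B = ∑ l, q l * (1 + s * y l)⁻¹) (hB1 : (1 + s) * B ≤ 1) :
    ∃ R : ℝ, 0 < R ∧
      (1 + R) * ∑ k, ∑ l, p k * q l * (1 + 3 * R * (x k * y l))⁻¹ ≤
        1 - (1 - (1 + r) * A) * (1 - (1 + s) * B) := by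
  have hr : 0 < r := hs.trans_le hsr
  have hA0 : 0 ≤ A := by
    rw [hA]
    exact Finset.sum_nonneg fun k _ => by have := hp k; have := hx k; positivity
  have hB0 : 0 ≤ B := by
    rw [hB]
    exact Finset.sum_nonneg fun k _ => by have := hq k; have := hy k; positivity
  have fin : ∀ R, 0 < R → R ≤ s → R ≤ r → R * (1 + r + s) ≤ r * s →
      (1 + R) * (A + B - A * B) ≤ 1 - (1 - (1 + r) * A) * (1 - (1 + s) * B) := by
    intro R hR hRs hRr hRrs
    have e : 1 - (1 - (1 + r) * A) * (1 - (1 + s) * B) - (1 + R) * (A + B - A * B)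
        = A * (1 - (1 + s) * B) * (r - R) + B * (1 - (1 + r) * A) * (s - R)
          + A * B * (r * s - R * (1 + r + s)) := by ring
    have h1 := mul_nonneg (mul_nonneg hA0 (sub_nonneg.2 hB1)) (sub_nonneg.2 hRr)
    have h2 := mul_nonneg (mul_nonneg hB0 (sub_nonneg.2 hA1)) (sub_nonneg.2 hRs)
    have h3 := mul_nonneg (mul_nonneg hA0 hB0) (sub_nonneg.2 hRrs)
    linarith
  rcases le_or_gt r 1 with h1 | h1
  -- With `3R = rs` the variables are `u = r x` and `v = s y`, and `1 + r + s ≤ 3` gives `R(1 + r +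
  -- s) ≤ rs`. The pointwise bound reads `1 - uv / ((1 + u)(1 + v)) ≥ 1 - uv / (1 + uv)`.
  · refine ⟨r * s / 3, by positivity, le_trans (mul_le_mul_of_nonneg_left ?_ (by positivity))
      (fin _ (by positivity) (by nlinarith) (by nlinarith) (by nlinarith [mul_pos hr hs]))⟩
    calc ∑ k, ∑ l, p k * q l * (1 + 3 * (r * s / 3) * (x k * y l))⁻¹
        ≤ ∑ k, ∑ l, (p k * (1 + r * x k)⁻¹ * q l + p k * (q l * (1 + s * y l)⁻¹)
            - p k * (1 + r * x k)⁻¹ * (q l * (1 + s * y l)⁻¹)) := by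
          refine Finset.sum_le_sum fun k _ => Finset.sum_le_sum fun l _ => ?_
          have hxk := mul_nonneg hr.le (hx k)
          have hyl := mul_nonneg hs.le (hy l)
          set u := r * x k
          set v := s * y l
          have e : 3 * (r * s / 3) * (x k * y l) = u * v := by simp only [u, v]; ring
          rw [e]
          have : (1 + u * v)⁻¹ ≤ (1 + u)⁻¹ + (1 + v)⁻¹ - (1 + u)⁻¹ * (1 + v)⁻¹ := by
            have e2 : (1 + u)⁻¹ + (1 + v)⁻¹ - (1 + u)⁻¹ * (1 + v)⁻¹
                = (1 + u + v) / ((1 + u) * (1 + v)) := by field_simp; ring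
            rw [e2, inv_eq_one_div, div_le_div_iff₀ (by positivity) (by positivity)]
            nlinarith [mul_nonneg hxk hyl, mul_nonneg hxk (mul_nonneg hxk hyl),
              mul_nonneg hyl (mul_nonneg hxk hyl)]
          have := mul_le_mul_of_nonneg_left this (mul_nonneg (hp k) (hq l))
          linarith
      _ = A + B - A * B := by
          simp_rw [Finset.sum_sub_distrib, Finset.sum_add_distrib, ← Finset.mul_sum, ← hB, hq1,
            ← Finset.sum_mul, hp1, ← hA]
          ring
  -- Now `3R = s`, and `1 + r + s ≤ 3r` gives `R(1 + r + s) ≤ rs`. Averaging over `x` first, at the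
  -- point `s y`, reduces to the Jensen bound.
  · refine ⟨s / 3, by positivity, le_trans (mul_le_mul_of_nonneg_left ?_ (by positivity))
      (fin _ (by positivity) (by linarith) (by linarith) (by nlinarith))⟩
    calc ∑ k, ∑ l, p k * q l * (1 + 3 * (s / 3) * (x k * y l))⁻¹
        = ∑ l, q l * ∑ k, p k * (1 + x k * (s * y l))⁻¹ := by
          rw [Finset.sum_comm]
          refine Finset.sum_congr rfl fun l _ => ?_
          rw [Finset.mul_sum]
          refine Finset.sum_congr rfl fun k _ => ?_
          rw [show 3 * (s / 3) * (x k * y l) = x k * (s * y l) by ring]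
          ring
      _ ≤ ∑ l, q l * (A + (1 - A) * (1 + s * y l)⁻¹) :=
          Finset.sum_le_sum fun l _ => mul_le_mul_of_nonneg_left
            (average_inv_one_add_mul_le p x hp hp1 hx hr (mul_nonneg hs.le (hy l)) hA hA1) (hq l)
      _ = A + B - A * B := by
          have : ∀ l, q l * (A + (1 - A) * (1 + s * y l)⁻¹)
              = q l * A + (1 - A) * (q l * (1 + s * y l)⁻¹) := fun l => by ring
          simp_rw [this]
          rw [Finset.sum_add_distrib, ← Finset.sum_mul, ← Finset.mul_sum, hq1, ← hB]
          ring

theorem exists_average_inv_le {κ ι : Type*} [Fintype κ] [Fintype ι] (p x : κ → ℝ)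
    (q y : ι → ℝ) (hp : ∀ k, 0 ≤ p k) (hq : ∀ l, 0 ≤ q l) (hp1 : ∑ k, p k = 1)
    (hq1 : ∑ l, q l = 1) (hx : ∀ k, 0 ≤ x k) (hy : ∀ l, 0 ≤ y l) {r s : ℝ}
    (hr : 0 < r) (hs : 0 < s)
    (hA1 : (1 + r) * ∑ k, p k * (1 + r * x k)⁻¹ ≤ 1)
    (hB1 : (1 + s) * ∑ l, q l * (1 + s * y l)⁻¹ ≤ 1) :
    ∃ R : ℝ, 0 < R ∧
      (1 + R) * ∑ k, ∑ l, p k * q l * (1 + 3 * R * (x k * y l))⁻¹ ≤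
        1 - (1 - (1 + r) * ∑ k, p k * (1 + r * x k)⁻¹)
          * (1 - (1 + s) * ∑ l, q l * (1 + s * y l)⁻¹) := by
  rcases le_total s r with h | h
  · exact exists_average_inv_le_of_le p x q y hp hq hp1 hq1 hx hy hs h rfl hA1 rfl hB1
  · obtain ⟨R, hR, h⟩ := exists_average_inv_le_of_le q y p x hq hp hq1 hp1 hy hx hr h rfl hB1
      rfl hA1
    refine ⟨R, hR, le_trans (le_of_eq ?_) (h.trans (le_of_eq (by ring)))⟩
    rw [Finset.sum_comm]
    refine congrArg _ (Finset.sum_congr rfl fun l _ => Finset.sum_congr rfl fun k _ => ?_)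
    rw [mul_comm (p k), mul_comm (x k)]

/-! ### Functional calculus in a fixed eigenbasis -/

section Spectral

variable {n : Type*} [Fintype n] [DecidableEq n]

/-- The operator with eigenvalues `h` in the basis given by the columns of `U`. -/
def specOp (U : Matrix n n ℂ) (h : n → ℝ) : Matrix n n ℂ :=
  U * diagonal (fun i => (h i : ℂ)) * Uᴴ

theorem specOp_mul {U : Matrix n n ℂ} (hU : Uᴴ * U = 1) (g h : n → ℝ) :
    specOp U g * specOp U h = specOp U (fun i => g i * h i) := by
  have : specOp U g * specOp U h = U * (diagonal (fun i => (g i : ℂ)) * (Uᴴ * U)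
      * diagonal (fun i => (h i : ℂ))) * Uᴴ := by simp only [specOp, Matrix.mul_assoc]
  rw [this, hU, Matrix.mul_one, diagonal_mul_diagonal, specOp]
  simp only [Complex.ofReal_mul]

theorem specOp_one {U : Matrix n n ℂ} (hU : U * Uᴴ = 1) : specOp U (fun _ => 1) = 1 := by
  simp [specOp, hU]

theorem specOp_isHermitian (U : Matrix n n ℂ) (h : n → ℝ) : (specOp U h)ᴴ = specOp U h := by
  simp only [specOp, conjTranspose_mul, conjTranspose_conjTranspose, diagonal_conjTranspose,
    Matrix.mul_assoc]
  congr 3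
  ext i
  simp

theorem specOp_posSemidef (U : Matrix n n ℂ) {h : n → ℝ} (hh : ∀ i, 0 ≤ h i) :
    (specOp U h).PosSemidef := by
  refine PosSemidef.mul_mul_conjTranspose_same (PosSemidef.diagonal fun i => ?_) U
  simpa using hh i

theorem specOp_add (U : Matrix n n ℂ) (g h : n → ℝ) :
    specOp U (fun i => g i + h i) = specOp U g + specOp U h := by
  simp only [specOp, Complex.ofReal_add, ← diagonal_add, Matrix.mul_add, Matrix.add_mul]

theorem specOp_const_mul (U : Matrix n n ℂ) (c : ℝ) (h : n → ℝ) :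
    specOp U (fun i => c * h i) = (c : ℂ) • specOp U h := by
  have : diagonal (fun i => ((c * h i : ℝ) : ℂ)) = (c : ℂ) • diagonal (fun i => (h i : ℂ)) := by
    ext i j
    by_cases hij : i = j <;> simp [diagonal, hij]
  rw [specOp, this, Matrix.mul_smul, Matrix.smul_mul, specOp]

theorem trace_mul_specOp (ρ U : Matrix n n ℂ) (h : n → ℝ) :
    (ρ * specOp U h).trace = ∑ i, (Uᴴ * ρ * U) i i * h i := by
  have : (ρ * specOp U h).trace = (Uᴴ * ρ * U * diagonal (fun i => (h i : ℂ))).trace := by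
    rw [specOp, ← Matrix.mul_assoc, trace_mul_comm]
    simp only [Matrix.mul_assoc]
  rw [this, trace]
  simp [mul_diagonal]

theorem exists_specOp_of_posSemidef {W : Matrix n n ℂ} (hW : W.PosSemidef) :
    ∃ (U : Matrix n n ℂ) (w : n → ℝ), Uᴴ * U = 1 ∧ U * Uᴴ = 1 ∧ (∀ i, 0 ≤ w i) ∧
      W = specOp U w := by
  refine ⟨hW.1.eigenvectorUnitary, hW.1.eigenvalues, ?_, ?_, hW.eigenvalues_nonneg, ?_⟩
  · exact Unitary.coe_star_mul_self _
  · exact Unitary.coe_mul_star_self _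
  · conv_lhs => rw [hW.1.spectral_theorem, Unitary.conjStarAlgAut_apply]
    rfl

theorem PosSemidef.exists_pinv {P : Matrix n n ℂ} (hP : P.PosSemidef) :
    ∃ J : Matrix n n ℂ, Jᴴ = J ∧ J * P = P * J ∧ P * J * P = P ∧ J * P * J = J := by
  obtain ⟨U, w, hU, -, -, rfl⟩ := exists_specOp_of_posSemidef hP
  refine ⟨specOp U (fun i => (w i)⁻¹), specOp_isHermitian _ _, ?_, ?_, ?_⟩
  · rw [specOp_mul hU, specOp_mul hU]
    simp only [mul_comm]
  · rw [specOp_mul hU, specOp_mul hU]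
    simp
  · rw [specOp_mul hU, specOp_mul hU]
    congr 1
    ext i
    rcases eq_or_ne (w i) 0 with h | h
    · simp [h]
    · field_simp

end Spectral

/-! ### Two-sided bounds on the fidelity -/

theorem re_trace_conjTranspose_mul_le {n m : Type*} [Fintype n] [Fintype m] (A B : Matrix m n ℂ) :
    (Aᴴ * B).trace.re ≤ ((Aᴴ * A).trace.re + (Bᴴ * B).trace.re) / 2 := by
  have h := (Complex.nonneg_iff.1 (posSemidef_conjTranspose_mul_self (A - B)).trace_nonneg).1
  have e : (Bᴴ * A).trace.re = (Aᴴ * B).trace.re := by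
    rw [← conjTranspose_conjTranspose A, ← conjTranspose_mul, trace_conjTranspose]
    simp
  simp only [conjTranspose_sub, Matrix.sub_mul, Matrix.mul_sub, trace_sub, Complex.sub_re] at h
  linarith

section Fidelity

variable {n m : Type*} [Fintype n] [DecidableEq n] [Fintype m]

/-- Polar decomposition with `K = R * J`, where `J` is the pseudoinverse of `P`. Then `Kᴴ * K = J *
P` is the support projection of `P`, so `K` is a contraction. -/
theorem exists_polar {P : Matrix n n ℂ} (hP : P.PosSemidef) {R : Matrix m n ℂ}
    (hR : Rᴴ * R = P * P) :
    ∃ K : Matrix m n ℂ, K * P = R ∧ Kᴴ * R = P ∧ (1 - Kᴴ * K).PosSemidef := by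
  obtain ⟨J, hJ, hJP, h1, h2⟩ := PosSemidef.exists_pinv hP
  have hPh : Pᴴ = P := hP.1
  have hKK : (R * J)ᴴ * (R * J) = J * P := by
    calc (R * J)ᴴ * (R * J) = J * (Rᴴ * R) * J := by
          rw [conjTranspose_mul, hJ]; simp only [Matrix.mul_assoc]
      _ = J * P * (P * J) := by rw [hR]; simp only [Matrix.mul_assoc]
      _ = J * P * J * P := by rw [← hJP]; simp only [Matrix.mul_assoc]
      _ = J * P := by rw [h2]
  -- The difference vanishes because its Gram matrix does.
  have hKP : R * J * P = R := by
    have h0 : (R - R * J * P)ᴴ * (R - R * J * P) = 0 := by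
      have e1 : (R * J * P)ᴴ = P * J * Rᴴ := by
        rw [conjTranspose_mul, conjTranspose_mul, hJ, hPh, Matrix.mul_assoc]
      rw [conjTranspose_sub, e1]
      have e2 : P * P * J * P = P * P := by
        rw [Matrix.mul_assoc, Matrix.mul_assoc, ← Matrix.mul_assoc P J P, h1]
      calc (Rᴴ - P * J * Rᴴ) * (R - R * J * P)
          = (Rᴴ * R) - (Rᴴ * R) * J * P - P * J * (Rᴴ * R) + P * J * ((Rᴴ * R) * J * P) := by
            simp only [Matrix.sub_mul, Matrix.mul_sub, Matrix.mul_assoc]; abel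
        _ = 0 := by rw [hR, e2]; simp
    exact (sub_eq_zero.1 (conjTranspose_mul_self_eq_zero.1 h0)).symm
  refine ⟨R * J, hKP, ?_, ?_⟩
  · calc (R * J)ᴴ * R = J * (Rᴴ * R) := by rw [conjTranspose_mul, hJ, Matrix.mul_assoc]
      _ = P := by rw [hR, ← Matrix.mul_assoc, hJP, h1]
  · rw [hKK]
    have : 1 - J * P = (1 - J * P)ᴴ * (1 - J * P) := by
      rw [conjTranspose_sub, conjTranspose_mul, hJ, hPh, conjTranspose_one, ← hJP]
      have : J * P * (J * P) = J * P := by rw [← Matrix.mul_assoc, h2]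
      rw [Matrix.sub_mul, Matrix.mul_sub, Matrix.mul_sub, this]; simp
    rw [this]
    exact posSemidef_conjTranspose_mul_self _

theorem trace_mul_re_nonneg {A B : Matrix n n ℂ} (hA : A.PosSemidef) (hB : B.PosSemidef) :
    0 ≤ (A * B).trace.re := by
  obtain ⟨C, rfl⟩ := CStarAlgebra.nonneg_iff_eq_star_mul_self.1 (nonneg_iff_posSemidef.2 hB)
  rw [← Matrix.mul_assoc, trace_mul_comm, ← Matrix.mul_assoc]
  exact (Complex.nonneg_iff.1 (hA.mul_mul_conjTranspose_same C).trace_nonneg).1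

theorem trace_contraction_le {l : Type*} [Fintype l] {K : Matrix m n ℂ}
    (hK : (1 - Kᴴ * K).PosSemidef) (B : Matrix n l ℂ) :
    ((K * B)ᴴ * (K * B)).trace.re ≤ (Bᴴ * B).trace.re := by
  have h := (Complex.nonneg_iff.1 (hK.conjTranspose_mul_mul_same B).trace_nonneg).1
  have e : Bᴴ * (1 - Kᴴ * K) * B = Bᴴ * B - (K * B)ᴴ * (K * B) := by
    simp only [Matrix.mul_sub, Matrix.sub_mul, conjTranspose_mul, Matrix.mul_assoc, Matrix.one_mul]
  rw [e, trace_sub, Complex.sub_re] at h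
  linarith

theorem sqrt_posSemidef (A : Matrix n n ℂ) : (CFC.sqrt A).PosSemidef :=
  nonneg_iff_posSemidef.1 (CFC.sqrt_nonneg A)

theorem sqrt_mul_sqrt {A : Matrix n n ℂ} (hA : A.PosSemidef) : CFC.sqrt A * CFC.sqrt A = A :=
  CFC.sqrt_mul_sqrt_self A (nonneg_iff_posSemidef.2 hA)

/-- A joint purification of the two operators bounds the fidelity from below. -/
theorem re_trace_le_fidelity (R S : Matrix m n ℂ) :
    (Rᴴ * S).trace.re ≤ fidelity (Rᴴ * R) (Sᴴ * S) := by
  unfold fidelity traceNorm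
  have hPp := sqrt_posSemidef (Rᴴ * R)
  have hQp := sqrt_posSemidef (Sᴴ * S)
  obtain ⟨K, hK, -, hKc⟩ := exists_polar hPp
    (sqrt_mul_sqrt (posSemidef_conjTranspose_mul_self R)).symm
  obtain ⟨L, hL, -, hLc⟩ := exists_polar hQp
    (sqrt_mul_sqrt (posSemidef_conjTranspose_mul_self S)).symm
  set P := CFC.sqrt (Rᴴ * R)
  set Q := CFC.sqrt (Sᴴ * S)
  have hTp := sqrt_posSemidef ((P * Q)ᴴ * (P * Q))
  obtain ⟨J, hJ, -, hJc⟩ := exists_polar hTp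
    (sqrt_mul_sqrt (posSemidef_conjTranspose_mul_self (P * Q))).symm
  set T := CFC.sqrt ((P * Q)ᴴ * (P * Q))
  have hBB := sqrt_mul_sqrt hTp
  have hBh : (CFC.sqrt T)ᴴ = CFC.sqrt T := (sqrt_posSemidef T).1
  set B := CFC.sqrt T
  have hPh : Pᴴ = P := hPp.1
  have hQh : Qᴴ = Q := hQp.1
  have hTh : Tᴴ = T := hTp.1
  -- Writing `R = K P`, `S = L Q` and `P Q = J T` with contractions `K`, `L`, `J` and splitting `T =
  -- B * B`, the trace becomes an inner product of two operators, each of squared Hilbert–Schmidt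
  -- norm at most `Tr T`.
  have e : (Rᴴ * S).trace = ((K * (J * B))ᴴ * (L * B)).trace := by
    calc (Rᴴ * S).trace = (P * (Kᴴ * L * Q)).trace := by
          rw [← hK, ← hL, conjTranspose_mul, hPh]; simp only [Matrix.mul_assoc]
      _ = (Kᴴ * L * (P * Q)ᴴ).trace := by
          rw [trace_mul_comm, conjTranspose_mul, hPh, hQh]; simp only [Matrix.mul_assoc]
      _ = (Kᴴ * L * (B * B) * Jᴴ).trace := by
          rw [← hJ, conjTranspose_mul, hTh, hBB]; simp only [Matrix.mul_assoc]
      _ = (B * Jᴴ * Kᴴ * L * B).trace := by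
          rw [trace_mul_comm, show Jᴴ * (Kᴴ * L * (B * B)) = (Jᴴ * Kᴴ * L * B) * B by
            simp only [Matrix.mul_assoc], trace_mul_comm]
          simp only [Matrix.mul_assoc]
      _ = _ := by
          rw [conjTranspose_mul, conjTranspose_mul, hBh]; simp only [Matrix.mul_assoc]
  have hBT : (Bᴴ * B).trace.re = T.trace.re := by rw [hBh, hBB]
  rw [e]
  have h1 := re_trace_conjTranspose_mul_le (K * (J * B)) (L * B)
  have h2 := trace_contraction_le hKc (J * B)
  have h3 := trace_contraction_le hJc B
  have h4 := trace_contraction_le hLc B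
  linarith

/-- Dual bound on the fidelity: insert `G * G' = 1` between `√ρ` and `√τ` in `Tr Jᴴ √ρ √τ`, then use
Cauchy–Schwarz in arithmetic-mean form; the polar factor `J` is a contraction and drops out. -/
theorem fidelity_le_of_mul_eq_one {ρ τ G G' : Matrix n n ℂ} (hρ : ρ.PosSemidef)
    (hτ : τ.PosSemidef) (hG : Gᴴ = G) (hG' : G'ᴴ = G') (hGG : G * G' = 1) :
    fidelity ρ τ ≤ ((ρ * (G * G)).trace.re + (τ * (G' * G')).trace.re) / 2 := by
  unfold fidelity traceNorm
  have hPh : (CFC.sqrt ρ)ᴴ = CFC.sqrt ρ := (sqrt_posSemidef ρ).1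
  have hQh : (CFC.sqrt τ)ᴴ = CFC.sqrt τ := (sqrt_posSemidef τ).1
  have hPP := sqrt_mul_sqrt hρ
  have hQQ := sqrt_mul_sqrt hτ
  set P := CFC.sqrt ρ
  set Q := CFC.sqrt τ
  obtain ⟨J, -, hJ, hJc⟩ := exists_polar (sqrt_posSemidef ((P * Q)ᴴ * (P * Q)))
    (sqrt_mul_sqrt (posSemidef_conjTranspose_mul_self (P * Q))).symm
  rw [← hJ]
  have e : (Jᴴ * (P * Q)).trace = ((G * P)ᴴ * (G' * (Q * Jᴴ))).trace := by
    rw [trace_mul_comm, conjTranspose_mul, hG, hPh]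
    calc (P * Q * Jᴴ).trace = (P * (G * G') * (Q * Jᴴ)).trace := by
          rw [hGG, Matrix.mul_one, Matrix.mul_assoc]
      _ = _ := by simp only [Matrix.mul_assoc]
  have e1 : ((G * P)ᴴ * (G * P)).trace = (ρ * (G * G)).trace := by
    rw [conjTranspose_mul, hPh, hG, ← hPP, Matrix.mul_assoc P P, trace_mul_comm P (P * (G * G))]
    simp only [Matrix.mul_assoc]
  have e2 : ((G' * (Q * Jᴴ))ᴴ * (G' * (Q * Jᴴ))).trace
      = ((J * (G' * Q)ᴴ)ᴴ * (J * (G' * Q)ᴴ)).trace := by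
    rw [trace_mul_comm]
    simp only [conjTranspose_mul, conjTranspose_conjTranspose, hQh, hG', Matrix.mul_assoc]
  have e3 : (((G' * Q)ᴴ)ᴴ * (G' * Q)ᴴ).trace = (τ * (G' * G')).trace := by
    rw [conjTranspose_conjTranspose, conjTranspose_mul, hQh, hG', ← hQQ, Matrix.mul_assoc,
      trace_mul_comm]
    simp only [Matrix.mul_assoc]
  have h1 := re_trace_conjTranspose_mul_le (G * P) (G' * (Q * Jᴴ))
  have h2 := trace_contraction_le hJc (G' * Q)ᴴ
  rw [e3] at h2
  rw [e2, e1, ← e] at h1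
  linarith

theorem fidelity_nonneg (ρ τ : Matrix n n ℂ) : 0 ≤ fidelity ρ τ :=
  (Complex.nonneg_iff.1 (sqrt_posSemidef _).trace_nonneg).1

end Fidelity

/-! ### Compactness and positive functionals on matrices -/

section Compactness

variable {n : Type*} [Fintype n]

theorem isClosed_posSemidef : IsClosed {M : Matrix n n ℂ | M.PosSemidef} := by
  have : {M : Matrix n n ℂ | M.PosSemidef}
      = {M | Mᴴ = M} ∩ ⋂ x : n → ℂ, {M | 0 ≤ star x ⬝ᵥ (M *ᵥ x)} := by
    ext M
    simp only [Set.mem_ofPred_eq, posSemidef_iff_dotProduct_mulVec, Set.mem_inter_iff,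
      Set.mem_iInter]
    rfl
  rw [this]
  refine IsClosed.inter (isClosed_eq (by fun_prop) (by fun_prop)) (isClosed_iInter fun x => ?_)
  exact isClosed_le continuous_const (by fun_prop)

theorem norm_apply_le_trace_of_posSemidef {M : Matrix n n ℂ} (hM : M.PosSemidef) (i j : n) :
    ‖M i j‖ ≤ M.trace.re := by
  classical
  obtain ⟨C, rfl⟩ := CStarAlgebra.nonneg_iff_eq_star_mul_self.1 (nonneg_iff_posSemidef.2 hM)
  have hd : ∀ k, (star C * C) k k = ((∑ l, ‖C l k‖ ^ 2 : ℝ) : ℂ) := fun k => by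
    simp [mul_apply, ← Complex.normSq_eq_conj_mul_self,
      Complex.normSq_eq_norm_sq]
  have hle : ∀ k, ∑ l, ‖C l k‖ ^ 2 ≤ (star C * C).trace.re := fun k => by
    rw [trace, Complex.re_sum]
    simp_rw [diag_apply, hd, Complex.ofReal_re]
    exact Finset.single_le_sum (f := fun k => ∑ l, ‖C l k‖ ^ 2)
      (fun _ _ => Finset.sum_nonneg fun _ _ => sq_nonneg _) (Finset.mem_univ k)
  calc ‖(star C * C) i j‖ ≤ ∑ l, ‖C l i‖ * ‖C l j‖ := by
        rw [mul_apply]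
        refine (norm_sum_le _ _).trans (le_of_eq ?_)
        simp
    _ ≤ ∑ l, (‖C l i‖ ^ 2 + ‖C l j‖ ^ 2) / 2 :=
        Finset.sum_le_sum fun l _ => by nlinarith [sq_nonneg (‖C l i‖ - ‖C l j‖)]
    _ ≤ _ := by
        rw [← Finset.sum_div, Finset.sum_add_distrib]
        linarith [hle i, hle j]

theorem isCompact_posSemidef_trace_le (c : ℝ) :
    IsCompact {M : Matrix n n ℂ | M.PosSemidef ∧ M.trace.re ≤ c} := by
  refine IsCompact.of_isClosed_subset (s := Set.univ.pi fun _ => Set.univ.pi fun _ =>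
    Metric.closedBall (0 : ℂ) c) (isCompact_univ_pi fun _ => isCompact_univ_pi fun _ =>
      isCompact_closedBall _ _) (isClosed_posSemidef.inter
      (isClosed_le (Complex.continuous_re.comp (by fun_prop)) continuous_const)) ?_
  rintro M ⟨hM, hc⟩ i - j -
  simpa using (norm_apply_le_trace_of_posSemidef hM i j).trans hc

end Compactness

section Functional

variable {n : Type*} [Fintype n] [DecidableEq n]

theorem posSemidef_of_re_trace_nonneg {n : Type*} [Fintype n] {M : Matrix n n ℂ}
    (hM : M.IsHermitian) (h : ∀ x : n → ℂ, 0 ≤ (M * vecMulVec x (star x)).trace.re) :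
    M.PosSemidef := by
  refine PosSemidef.of_dotProduct_mulVec_nonneg hM fun x => ?_
  have := h x
  rw [mul_vecMulVec, trace_vecMulVec, dotProduct_comm] at this
  exact Complex.nonneg_iff.2 ⟨this, (hM.im_star_dotProduct_mulVec_self x).symm⟩

theorem exists_re_trace_eq (φ : Matrix n n ℂ →ₗ[ℝ] ℝ) :
    ∃ W : Matrix n n ℂ, ∀ A, φ A = (W * A).trace.re := by
  refine ⟨of fun i j => (φ (single j i 1) : ℂ) - Complex.I * φ (single j i Complex.I), fun A => ?_⟩
  have hA : A = ∑ i, ∑ j, ((A i j).re • single i j (1 : ℂ) + (A i j).im • single i j Complex.I) := by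
    conv_lhs => rw [matrix_eq_sum_single A]
    refine Finset.sum_congr rfl fun i _ => Finset.sum_congr rfl fun j _ => ?_
    rw [smul_single, smul_single, ← single_add]
    congr 1
    apply Complex.ext <;> simp
  conv_lhs => rw [hA]
  simp only [map_sum, map_add, map_smul, smul_eq_mul, trace, diag_apply, mul_apply, of_apply,
    Complex.re_sum]
  rw [Finset.sum_comm]
  refine Finset.sum_congr rfl fun i _ => Finset.sum_congr rfl fun j _ => ?_
  simp
  ring

theorem exists_posSemidef_re_trace_eq (φ : Matrix n n ℂ →ₗ[ℝ] ℝ)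
    (hφ : ∀ Q : Matrix n n ℂ, Q.PosSemidef → 0 ≤ φ Q) :
    ∃ W : Matrix n n ℂ, W.PosSemidef ∧ ∀ A, A.IsHermitian → φ A = (W * A).trace.re := by
  obtain ⟨V, hV⟩ := exists_re_trace_eq φ
  have key : ∀ A, A.IsHermitian → φ A = (((2⁻¹ : ℂ) • (V + Vᴴ)) * A).trace.re := by
    intro A hA
    have e : (Vᴴ * A).trace.re = (V * A).trace.re := by
      conv_lhs => rw [← hA.eq, ← conjTranspose_mul, trace_conjTranspose, trace_mul_comm]
      simp
    rw [hV, Matrix.smul_mul, trace_smul, Matrix.add_mul, trace_add]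
    simp [e]
    ring
  refine ⟨_, ?_, key⟩
  have hH : ((2⁻¹ : ℂ) • (V + Vᴴ)).IsHermitian := by
    rw [IsHermitian, conjTranspose_smul, conjTranspose_add, conjTranspose_conjTranspose, add_comm]
    simp
  refine posSemidef_of_re_trace_nonneg hH fun x => ?_
  rw [← key _ (posSemidef_vecMulVec_self_star x).1]
  exact hφ _ (posSemidef_vecMulVec_self_star x)

end Functional

/-! ### Semidefinite duality for the best fidelity -/

section Duality

variable {a b : Type*} [Fintype a]

/-- The partial trace over the first factor. -/
def traceLeft (W : Matrix (a × b) (a × b) ℂ) : Matrix b b ℂ :=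
  of fun e e' => ∑ x, W (x, e) (x, e')

theorem traceLeft_posSemidef {W : Matrix (a × b) (a × b) ℂ} (hW : W.PosSemidef) :
    (traceLeft W).PosSemidef := by
  have : traceLeft W = ∑ x, W.submatrix (fun e => (x, e)) (fun e => (x, e)) := by
    ext e e'
    simp [traceLeft, Matrix.sum_apply]
  rw [this]
  exact posSemidef_sum _ fun x _ => hW.submatrix _

theorem trace_mul_one_kronecker [DecidableEq a] [Fintype b] (W : Matrix (a × b) (a × b) ℂ) (ω : Matrix b b ℂ) :
    (W * ((1 : Matrix a a ℂ) ⊗ₖ ω)).trace = (traceLeft W * ω).trace := by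
  simp only [trace, diag_apply, mul_apply, traceLeft, of_apply, Fintype.sum_prod_type,
    kroneckerMap_apply, one_apply, Finset.sum_mul, ite_mul, one_mul, zero_mul, mul_ite, mul_zero]
  simp only [Finset.sum_ite_irrel, Finset.sum_const_zero, Finset.sum_ite_eq', Finset.mem_univ,
    if_true]
  rw [Finset.sum_comm]
  exact Finset.sum_congr rfl fun _ _ => Finset.sum_comm

variable [Fintype b]

/-- Pairs of a positive extension `M` of `ρ` and a bounded positive operator `ω`. -/
def extensionSet (ρ : Matrix (a × b) (a × b) ℂ) (c : ℝ) :
    Set (Matrix ((a × b) ⊕ (a × b)) ((a × b) ⊕ (a × b)) ℂ × Matrix b b ℂ) :=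
  {z | (z.1.PosSemidef ∧ z.1.toBlocks₁₁ = ρ ∧ z.1.toBlocks₂₂.trace.re ≤ 1) ∧
    z.2.PosSemidef ∧ z.2.trace.re ≤ c}

theorem isCompact_extensionSet (ρ : Matrix (a × b) (a × b) ℂ) (c : ℝ) :
    IsCompact (extensionSet ρ c) := by
  refine IsCompact.of_isClosed_subset ((isCompact_posSemidef_trace_le (ρ.trace.re + 1)).prod
    (isCompact_posSemidef_trace_le c)) ?_ ?_
  · have h1 : Continuous fun z : Matrix ((a × b) ⊕ (a × b)) ((a × b) ⊕ (a × b)) ℂ × Matrix b b ℂ =>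
        z.1.toBlocks₁₁ := by unfold toBlocks₁₁; fun_prop
    have h2 : Continuous fun z : Matrix ((a × b) ⊕ (a × b)) ((a × b) ⊕ (a × b)) ℂ × Matrix b b ℂ =>
        z.1.toBlocks₂₂.trace.re :=
      Complex.continuous_re.comp (Continuous.matrix_trace (by unfold toBlocks₂₂; fun_prop))
    have h3 : Continuous fun z : Matrix ((a × b) ⊕ (a × b)) ((a × b) ⊕ (a × b)) ℂ × Matrix b b ℂ =>
        z.2.trace.re := Complex.continuous_re.comp (by fun_prop)
    exact ((isClosed_posSemidef.preimage continuous_fst).inter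
      ((isClosed_eq h1 continuous_const).inter (isClosed_le h2 continuous_const))).inter
      ((isClosed_posSemidef.preimage continuous_snd).inter (isClosed_le h3 continuous_const))
  · rintro ⟨M, ω⟩ ⟨⟨hM, h1, h2⟩, hω, hc⟩
    refine ⟨⟨hM, ?_⟩, hω, hc⟩
    change M.trace.re ≤ _
    have : M.trace = M.toBlocks₁₁.trace + M.toBlocks₂₂.trace := by
      simp [trace, toBlocks₁₁, toBlocks₂₂]
    rw [this, Complex.add_re]
    simp only at h1 h2
    rw [h1]
    gcongr

theorem convex_extensionSet (ρ : Matrix (a × b) (a × b) ℂ) (c : ℝ) :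
    Convex ℝ (extensionSet ρ c) := by
  rintro ⟨M, ω⟩ ⟨⟨hM, h1, h2⟩, hω, hc⟩ ⟨M', ω'⟩ ⟨⟨hM', h1', h2'⟩, hω', hc'⟩ s t hs ht hst
  have e1 : (s • M + t • M').toBlocks₁₁ = s • M.toBlocks₁₁ + t • M'.toBlocks₁₁ := rfl
  have e2 : (s • M + t • M').toBlocks₂₂ = s • M.toBlocks₂₂ + t • M'.toBlocks₂₂ := rfl
  refine ⟨⟨(hM.smul hs).add (hM'.smul ht), ?_, ?_⟩, (hω.smul hs).add (hω'.smul ht), ?_⟩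
  · change (s • M + t • M').toBlocks₁₁ = ρ
    simp only at h1 h1'
    rw [e1, h1, h1', ← add_smul, hst, one_smul]
  · change (s • M + t • M').toBlocks₂₂.trace.re ≤ 1
    rw [e2, trace_add, trace_smul, trace_smul, Complex.add_re, Complex.smul_re, Complex.smul_re,
      smul_eq_mul, smul_eq_mul]
    simp only at h2 h2'
    nlinarith
  · change (s • ω + t • ω').trace.re ≤ c
    rw [trace_add, trace_smul, trace_smul, Complex.add_re, Complex.smul_re, Complex.smul_re,
      smul_eq_mul, smul_eq_mul]
    simp only at hc hc'
    calc s * ω.trace.re + t * ω'.trace.re ≤ s * c + t * c := by gcongr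
      _ = c := by rw [← add_mul, hst, one_mul]

variable [DecidableEq a]

/-- The slack and the objective of the fidelity maximization. -/
def objectiveMap :
    (Matrix ((a × b) ⊕ (a × b)) ((a × b) ⊕ (a × b)) ℂ × Matrix b b ℂ) →ₗ[ℝ]
      Matrix (a × b) (a × b) ℂ × ℝ where
  toFun z := ((1 : Matrix a a ℂ) ⊗ₖ z.2 - z.1.toBlocks₂₂, 2 * z.1.toBlocks₁₂.trace.re)
  map_add' x y := by
    refine Prod.ext ?_ ?_
    · ext i j
      simp [toBlocks₂₂, mul_add]
      ring
    · have : (x + y).1.toBlocks₁₂ = x.1.toBlocks₁₂ + y.1.toBlocks₁₂ := rfl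
      simp only [this, trace_add, Complex.add_re, mul_add, Prod.mk_add_mk]
  map_smul' c x := by
    refine Prod.ext ?_ ?_
    · ext i j
      simp [toBlocks₂₂]
      ring
    · have : (c • x).1.toBlocks₁₂ = c • x.1.toBlocks₁₂ := rfl
      simp only [this, trace_smul, Complex.smul_re, smul_eq_mul, Prod.smul_mk, RingHom.id_apply]
      ring

theorem continuous_objectiveMap : Continuous (objectiveMap (a := a) (b := b)) := by
  refine Continuous.prodMk ?_ ?_
  · refine continuous_matrix fun i j => ?_
    change Continuous fun z : Matrix ((a × b) ⊕ (a × b)) ((a × b) ⊕ (a × b)) ℂ × Matrix b b ℂ =>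
      (1 : Matrix a a ℂ) i.1 j.1 * z.2 i.2 j.2 - z.1 (Sum.inr i) (Sum.inr j)
    fun_prop
  · refine continuous_const.mul (Complex.continuous_re.comp (Continuous.matrix_trace ?_))
    unfold toBlocks₁₂
    fun_prop

instance : LocallyConvexSpace ℝ (Matrix (a × b) (a × b) ℂ) :=
  inferInstanceAs (LocallyConvexSpace ℝ ((a × b) → (a × b) → ℂ))

end Duality
section Duality

variable {a b : Type*} [Fintype a] [DecidableEq a] [Fintype b] [DecidableEq b]

theorem zero_mem_extensionSet {ρ : Matrix (a × b) (a × b) ℂ} (hρ : ρ.PosSemidef) {c : ℝ}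
    (hc : 0 ≤ c) : (fromBlocks ρ 0 0 0, 0) ∈ extensionSet ρ c := by
  refine ⟨⟨?_, by simp, by simp⟩, PosSemidef.zero, by simpa using hc⟩
  have e : fromBlocks ρ 0 0 (0 : Matrix (a × b) (a × b) ℂ)
      = (fromCols (1 : Matrix (a × b) (a × b) ℂ) (0 : Matrix (a × b) (a × b) ℂ))ᴴ * ρ
        * fromCols (1 : Matrix (a × b) (a × b) ℂ) (0 : Matrix (a × b) (a × b) ℂ) := by
    rw [conjTranspose_fromCols_eq_fromRows_conjTranspose, fromRows_mul, fromRows_mul_fromCols]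
    simp
  simp only
  rw [e]
  exact hρ.conjTranspose_mul_mul_same _

/-- Fidelity becomes linear on positive block matrices: the diagonal blocks are the two operators
and the off-diagonal trace is the overlap. If no point is feasible with value `h`, the compact image
of `objectiveMap` is strictly separated from the closed convex set of positive slacks and values at
least `h`; the functional, normalized in the value coordinate, is the witness `W`. -/
theorem exists_extension_or_separation {ρ : Matrix (a × b) (a × b) ℂ} (hρ : ρ.PosSemidef)
    {c h : ℝ} (hc : 0 ≤ c) (hh : 0 < h) :
    (∃ z ∈ extensionSet ρ c, ((1 : Matrix a a ℂ) ⊗ₖ z.2 - z.1.toBlocks₂₂).PosSemidef ∧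
      h ≤ 2 * z.1.toBlocks₁₂.trace.re) ∨
    ∃ (W : Matrix (a × b) (a × b) ℂ) (g : ℝ), W.PosSemidef ∧ g < h ∧ ∀ z ∈ extensionSet ρ c,
      (traceLeft W * z.2).trace.re - (W * z.1.toBlocks₂₂).trace.re
        + 2 * z.1.toBlocks₁₂.trace.re ≤ g := by
  rw [or_iff_not_imp_left]
  intro hno
  have hdisj : Disjoint (objectiveMap '' extensionSet ρ c)
      ({Q : Matrix (a × b) (a × b) ℂ | Q.PosSemidef} ×ˢ Set.Ici h) := by
    rw [Set.disjoint_left]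
    rintro _ ⟨z, hz, rfl⟩ ⟨h1, h2⟩
    exact hno ⟨z, hz, h1, h2⟩
  have hconv : Convex ℝ ({Q : Matrix (a × b) (a × b) ℂ | Q.PosSemidef}) :=
    fun A hA B hB s t hs ht _ => (hA.smul hs).add (hB.smul ht)
  obtain ⟨φ, u, v, h1, huv, h2⟩ := geometric_hahn_banach_compact_closed
    ((convex_extensionSet ρ c).linear_image objectiveMap)
    ((isCompact_extensionSet ρ c).image continuous_objectiveMap)
    (hconv.prod (convex_Ici h)) (isClosed_posSemidef.prod isClosed_Ici) hdisj
  have hsplit : ∀ A t, φ (A, t) = φ (A, 0) + t * φ (0, 1) := by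
    intro A t
    have : ((A, t) : Matrix (a × b) (a × b) ℂ × ℝ) = (A, 0) + t • (0, 1) := by simp
    rw [this, map_add, map_smul, smul_eq_mul]
  have hu0 : 0 < u := by
    have := h1 _ ⟨_, zero_mem_extensionSet hρ hc, rfl⟩
    have e : objectiveMap (fromBlocks ρ 0 0 0, (0 : Matrix b b ℂ))
      = (0 : Matrix (a × b) (a × b) ℂ × ℝ) := by
      refine Prod.ext ?_ ?_ <;> simp [objectiveMap]
    rwa [e, map_zero] at this
  have hτ : 0 < φ (0, 1) := by
    have := h2 (0, h) ⟨PosSemidef.zero, le_refl h⟩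
    rw [hsplit] at this
    have h0 : φ ((0 : Matrix (a × b) (a × b) ℂ), (0 : ℝ)) = 0 := map_zero φ
    rw [h0] at this
    by_contra hcon
    push Not at hcon
    nlinarith
  set τ := φ (0, 1)
  have hpos : ∀ Q : Matrix (a × b) (a × b) ℂ, Q.PosSemidef → 0 ≤ φ (Q, 0) := by
    intro Q hQ
    by_contra! hneg
    have hk : ∀ k : ℝ, 0 ≤ k → v < k * φ (Q, 0) + h * τ := by
      intro k hk
      have := h2 (k • Q, h) ⟨hQ.smul hk, le_refl h⟩
      rw [hsplit] at this
      have e : ((k • Q, (0 : ℝ)) : Matrix (a × b) (a × b) ℂ × ℝ) = k • (Q, 0) := by simp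
      rwa [e, map_smul, smul_eq_mul] at this
    -- This multiple makes the right side of `hk` zero, whereas `v > u > 0`.
    have := hk (h * τ / (-φ (Q, 0))) (by have := neg_pos.2 hneg; positivity)
    rw [div_neg, neg_mul, div_mul_cancel₀ _ hneg.ne] at this
    linarith
  have hcomp := exists_posSemidef_re_trace_eq
    (τ⁻¹ • (φ.toLinearMap ∘ₗ LinearMap.inl ℝ (Matrix (a × b) (a × b) ℂ) ℝ))
    (fun Q hQ => mul_nonneg (inv_nonneg.2 hτ.le) (hpos Q hQ))
  obtain ⟨W, hW, hWφ⟩ := hcomp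
  refine ⟨W, u / τ, hW, ?_, ?_⟩
  · rw [div_lt_iff₀ hτ]
    have := h2 (0, h) ⟨PosSemidef.zero, le_refl h⟩
    rw [hsplit] at this
    have h0 : φ ((0 : Matrix (a × b) (a × b) ℂ), (0 : ℝ)) = 0 := map_zero φ
    rw [h0] at this
    linarith
  · intro z hz
    have hherm : ((1 : Matrix a a ℂ) ⊗ₖ z.2 - z.1.toBlocks₂₂).IsHermitian :=
      (PosSemidef.one.kronecker hz.2.1).1.sub (hz.1.1.submatrix Sum.inr).1
    have e := hWφ _ hherm
    have := h1 _ ⟨z, hz, rfl⟩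
    have e2 : objectiveMap z = ((1 : Matrix a a ℂ) ⊗ₖ z.2 - z.1.toBlocks₂₂,
      2 * z.1.toBlocks₁₂.trace.re) := rfl
    rw [e2, hsplit] at this
    rw [Matrix.mul_sub, trace_sub, trace_mul_one_kronecker, Complex.sub_re] at e
    rw [← e, le_div_iff₀ hτ]
    have e3 : (τ⁻¹ • (φ.toLinearMap ∘ₗ LinearMap.inl ℝ (Matrix (a × b) (a × b) ℂ) ℝ))
      ((1 : Matrix a a ℂ) ⊗ₖ z.2 - z.1.toBlocks₂₂)
      = τ⁻¹ * φ ((1 : Matrix a a ℂ) ⊗ₖ z.2 - z.1.toBlocks₂₂, 0) := rfl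
    rw [e3, add_mul, mul_comm τ⁻¹, mul_assoc, inv_mul_cancel₀ hτ.ne', mul_one]
    exact this.le

/-- Approximate complementary slackness for the constraint `Tr τ ≤ 1`, whose multiplier is `s`:
either the constraint holds already at `s = δ`, or it holds with equality at a larger `s` by the
intermediate value theorem. Keeping `s` positive makes `s + w k` invertible. -/
theorem exists_shift {κ : Type*} [Fintype κ] (p w : κ → ℝ) (hp : ∀ k, 0 ≤ p k)
    (hp1 : ∑ k, p k ≤ 1) (hw : ∀ k, 0 ≤ w k) {δ : ℝ} (hδ : 0 < δ) :
    ∃ s : ℝ, 0 < s ∧ ∑ k, p k * ((s + w k)⁻¹) ^ 2 ≤ 1 ∧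
      s - δ ≤ s * ∑ k, p k * ((s + w k)⁻¹) ^ 2 := by
  set H : ℝ → ℝ := fun s => ∑ k, p k * ((s + w k)⁻¹) ^ 2 with hH
  have hH0 : ∀ s, 0 ≤ H s := fun s =>
    Finset.sum_nonneg fun k _ => mul_nonneg (hp k) (sq_nonneg _)
  rcases le_or_gt (H δ) 1 with h | h
  · exact ⟨δ, hδ, h, by rw [sub_self]; exact mul_nonneg hδ.le (hH0 δ)⟩
  · have hle : δ ≤ max δ 1 := le_max_left _ _
    have hcont : ContinuousOn H (Set.Icc δ (max δ 1)) := by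
      refine continuousOn_finsetSum _ fun k _ => continuousOn_const.mul
        (((continuousOn_id.add continuousOn_const).inv₀ fun s hs => ?_).pow 2)
      have : 0 < s := hδ.trans_le hs.1
      exact (add_pos_of_pos_of_nonneg this (hw k)).ne'
    have hmax : H (max δ 1) ≤ 1 := by
      refine le_trans (Finset.sum_le_sum fun k _ => ?_) hp1
      have h1 : 1 ≤ max δ 1 + w k := le_add_of_le_of_nonneg (le_max_right _ _) (hw k)
      have h2 : (max δ 1 + w k)⁻¹ ≤ 1 := inv_le_one_of_one_le₀ h1
      have h3 : 0 ≤ (max δ 1 + w k)⁻¹ := by positivity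
      exact mul_le_of_le_one_right (hp k) (pow_le_one₀ h3 h2)
    obtain ⟨s, hs, hs1⟩ := intermediate_value_Icc' hle hcont ⟨hmax, h.le⟩
    refine ⟨s, hδ.trans_le hs.1, hs1.le, ?_⟩
    change s - δ ≤ s * H s
    rw [hs1]
    linarith

/-- A feasible block matrix factors as a Gram matrix whose two column blocks are `R` and `S`.
Otherwise, evaluating the separating functional at a nearly optimal extension turns it into an
explicit bound on the spectrum and the marginal of `W`. -/
theorem exists_purification_or_dual {ρ : Matrix (a × b) (a × b) ℂ} (hρ : IsState ρ)
    {c h : ℝ} (hc : 0 < c) (hh : 0 < h) :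
    (∃ (R S : Matrix ((a × b) ⊕ (a × b)) (a × b) ℂ) (ω : Matrix b b ℂ), Rᴴ * R = ρ ∧
      (Sᴴ * S).trace.re ≤ 1 ∧ ω.PosSemidef ∧ ω.trace.re ≤ c ∧
      ((1 : Matrix a a ℂ) ⊗ₖ ω - Sᴴ * S).PosSemidef ∧ h ≤ (Rᴴ * S).trace.re) ∨
    ∃ (U : Matrix (a × b) (a × b) ℂ) (w : a × b → ℝ) (s μ : ℝ), Uᴴ * U = 1 ∧ U * Uᴴ = 1 ∧
      (∀ k, 0 ≤ w k) ∧ 0 < s ∧ 0 < μ ∧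
      ((μ : ℂ) • (1 : Matrix b b ℂ) - traceLeft (specOp U w)).PosSemidef ∧
      ∑ k, ((Uᴴ * ρ * U) k k).re * (s + w k)⁻¹ + (s + c * μ) < 2 * h := by
  rcases exists_extension_or_separation hρ.1 hc.le (mul_pos two_pos hh) with
    ⟨⟨M, ω⟩, ⟨⟨hM, hM1, hM2⟩, hω, hωc⟩, hle, hval⟩ | ⟨W, g, hW, hg, hdual⟩
  · left
    obtain ⟨N, rfl⟩ := CStarAlgebra.nonneg_iff_eq_star_mul_self.1 (nonneg_iff_posSemidef.2 hM)
    refine ⟨N.submatrix id Sum.inl, N.submatrix id Sum.inr, ω, hM1, hM2, hω, hωc, hle, ?_⟩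
    exact le_of_mul_le_mul_left hval two_pos
  · right
    obtain ⟨U, w, hU, hU', hw, rfl⟩ := exists_specOp_of_posSemidef hW
    set p : a × b → ℝ := fun k => ((Uᴴ * ρ * U) k k).re with hpdef
    have hpp := hρ.1.conjTranspose_mul_mul_same U
    have hpc : ∀ k, (Uᴴ * ρ * U) k k = (p k : ℂ) := fun k =>
      Complex.ext rfl (by simpa using (Complex.nonneg_iff.1 (hpp.diag_nonneg (i := k))).2.symm)
    have hp : ∀ k, 0 ≤ p k := fun k => (Complex.nonneg_iff.1 (hpp.diag_nonneg (i := k))).1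
    have hptr : ∀ f : a × b → ℝ, (ρ * specOp U f).trace.re = ∑ k, p k * f k := fun f => by
      rw [trace_mul_specOp, Complex.re_sum]
      simp [hpc]
    have hp1 : ∑ k, p k = 1 := by
      have := hptr (fun _ => 1)
      rw [specOp_one hU', Matrix.mul_one, hρ.2] at this
      simpa using this.symm
    set η := (2 * h - g) / 4 with hη
    have hηpos : 0 < η := by rw [hη]; linarith
    obtain ⟨s, hs, hH1, hsH⟩ := exists_shift p w hp hp1.le hw hηpos
    have hsw : ∀ k, 0 < s + w k := fun k => add_pos_of_pos_of_nonneg hs (hw k)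
    set y : a × b → ℝ := fun k => (s + w k)⁻¹ with hy
    set H := ∑ k, p k * (y k) ^ 2 with hHdef
    set A := ∑ k, p k * y k with hA
    have hYh : (specOp U y)ᴴ = specOp U y := specOp_isHermitian U y
    have hM : ∀ ω : Matrix b b ℂ, ω.PosSemidef → ω.trace.re ≤ c →
        (traceLeft (specOp U w) * ω).trace.re ≤ g + η - A - s := by
      intro ω hω hωc
      -- For `Y = (s + W)⁻¹` this is the stationary point of `2 Tr(ρY) - Tr((s + W)YρY)`; the choice
      -- of `s` ensures `Tr(YρY) ≤ 1`.
      have hmem : (fromBlocks ρ (ρ * specOp U y) (specOp U y * ρ)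
          (specOp U y * ρ * specOp U y), ω) ∈ extensionSet ρ c := by
        refine ⟨⟨?_, by simp, ?_⟩, hω, hωc⟩
        · have e : fromBlocks ρ (ρ * specOp U y) (specOp U y * ρ) (specOp U y * ρ * specOp U y)
              = (fromCols (1 : Matrix (a × b) (a × b) ℂ) (specOp U y))ᴴ * ρ
                * fromCols 1 (specOp U y) := by
            rw [conjTranspose_fromCols_eq_fromRows_conjTranspose, fromRows_mul,
              fromRows_mul_fromCols, hYh]
            simp
          rw [e]
          exact hρ.1.conjTranspose_mul_mul_same _
        · simp only [toBlocks_fromBlocks₂₂]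
          rw [trace_mul_comm, ← Matrix.mul_assoc, specOp_mul hU, trace_mul_comm, hptr]
          simpa only [hHdef, sq] using hH1
      have := hdual _ hmem
      simp only [toBlocks_fromBlocks₂₂, toBlocks_fromBlocks₁₂] at this
      have e1 : (specOp U w * (specOp U y * ρ * specOp U y)).trace.re
          = ∑ k, p k * (y k * (w k * y k)) := by
        rw [← hptr, ← specOp_mul hU, ← specOp_mul hU, Matrix.mul_assoc (specOp U y) ρ,
          ← Matrix.mul_assoc (specOp U w), trace_mul_comm, Matrix.mul_assoc ρ]
      rw [e1, hptr] at this
      have e2 : 2 * A - ∑ k, p k * (y k * (w k * y k)) = A + s * H := by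
        rw [hA, hHdef, Finset.mul_sum, Finset.mul_sum, ← Finset.sum_sub_distrib,
          ← Finset.sum_add_distrib]
        refine Finset.sum_congr rfl fun k _ => ?_
        have : y k * (s + w k) = 1 := inv_mul_cancel₀ (hsw k).ne'
        linear_combination (-(p k * y k)) * this
      linarith
    -- One extra `η` beyond the bound `hM` makes `μ` strictly positive. The total `A + s + cμ = g +
    -- 2η` is the midpoint of `g` and `2h`.
    set μ := (g + 2 * η - A - s) / c with hμ
    have hcμ : c * μ = g + 2 * η - A - s := by rw [hμ]; field_simp
    have hμ0 : 0 < μ := by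
      have := hM 0 PosSemidef.zero (by simpa using hc.le)
      simp only [Matrix.mul_zero, trace_zero, Complex.zero_re] at this
      exact pos_of_mul_pos_right (by rw [hcμ]; linarith) hc.le
    refine ⟨U, w, s, μ, hU, hU', hw, hs, hμ0, ?_, ?_⟩
    · refine posSemidef_of_re_trace_nonneg ((PosSemidef.one.smul ?_).1.sub
        (traceLeft_posSemidef (specOp_posSemidef U hw)).1) fun x => ?_
      · exact Complex.zero_le_real.2 hμ0.le
      · have hv := posSemidef_vecMulVec_self_star x
        set v := vecMulVec x (star x)
        rw [Matrix.sub_mul, trace_sub, Matrix.smul_mul, trace_smul, Matrix.one_mul, smul_eq_mul,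
          Complex.sub_re, Complex.re_ofReal_mul, sub_nonneg]
        have hvt := Complex.nonneg_iff.1 hv.trace_nonneg
        rcases hvt.1.eq_or_lt with h0 | h0
        · have : v.trace = 0 := Complex.ext h0.symm hvt.2.symm
          rw [hv.trace_eq_zero_iff.1 this]
          simp
        -- Rescaling the test operator to trace `c` converts the bound over all `ω` into an operator
        -- inequality.
        · have := hM ((c / v.trace.re) • v) (hv.smul (by positivity)) (by
            rw [trace_smul, Complex.smul_re, smul_eq_mul, div_mul_cancel₀ _ h0.ne'])
          rw [Matrix.mul_smul, trace_smul, Complex.smul_re, smul_eq_mul] at this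
          have h3 : c / v.trace.re * (traceLeft (specOp U w) * v).trace.re ≤ c * μ := by
            rw [hcμ]; linarith
          rw [div_mul_eq_mul_div, div_le_iff₀ h0, mul_assoc] at h3
          exact le_of_mul_le_mul_left h3 hc
    · change A + (s + c * μ) < 2 * h
      rw [hcμ]
      linarith

end Duality
-- Partial traces and product states
-- The partial trace is adjoint to tensoring with the identity; identities between reduced states
-- are then proved by testing against operators.
theorem trace_partialTrace_mul {n a b : Type*} [Fintype n] [Fintype a] [DecidableEq a]
    [DecidableEq b] (keep : n → a) (discard : n → b) (M : Matrix n n ℂ) (N : Matrix a a ℂ) :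
    (partialTrace keep discard M * N).trace =
      (M * of fun p q => if discard p = discard q then N (keep p) (keep q) else 0).trace := by
  simp only [trace, diag_apply, mul_apply, partialTrace, of_apply, Finset.sum_mul, ite_mul,
    zero_mul, mul_ite, mul_zero]
  calc _ = ∑ p, ∑ q, ∑ s, ∑ t, (if keep p = s ∧ keep q = t ∧ discard p = discard q then
          M p q * N t s else 0) := by
        have h1 : ∀ s, ∑ t, ∑ p, ∑ q, (if keep p = s ∧ keep q = t ∧ discard p = discard q then
          M p q * N t s else 0) = ∑ p, ∑ q, ∑ t, (if keep p = s ∧ keep q = t ∧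
          discard p = discard q then M p q * N t s else 0) := fun s => by
          rw [Finset.sum_comm]
          exact Finset.sum_congr rfl fun p _ => Finset.sum_comm
        simp_rw [h1]
        rw [Finset.sum_comm]
        exact Finset.sum_congr rfl fun p _ => Finset.sum_comm
    _ = _ := by
        refine Finset.sum_congr rfl fun p _ => Finset.sum_congr rfl fun q _ => ?_
        simp [ite_and, Finset.sum_ite_irrel, eq_comm]

section PiKron

variable {ι : Type*} [Fintype ι] [DecidableEq ι] {n : ι → Type*} [∀ i, Fintype (n i)]

/-- The tensor product of a finite family of operators. -/
def piKron (G : ∀ i, Matrix (n i) (n i) ℂ) : Matrix (∀ i, n i) (∀ i, n i) ℂ :=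
  of fun p q => ∏ i, G i (p i) (q i)

theorem piKron_mul (G H : ∀ i, Matrix (n i) (n i) ℂ) :
    piKron G * piKron H = piKron fun i => G i * H i := by
  ext p q
  simp only [mul_apply, piKron, of_apply, ← Finset.prod_mul_distrib, Finset.prod_univ_sum,
    Fintype.piFinset_univ]

theorem trace_piKron (G : ∀ i, Matrix (n i) (n i) ℂ) :
    (piKron G).trace = ∏ i, (G i).trace := by
  simp only [trace, diag_apply, piKron, of_apply, Finset.prod_univ_sum, Fintype.piFinset_univ]

theorem piKron_posSemidef {G : ∀ i, Matrix (n i) (n i) ℂ} (hG : ∀ i, (G i).PosSemidef) :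
    (piKron G).PosSemidef := by
  classical
  choose C hC using fun i =>
    CStarAlgebra.nonneg_iff_eq_star_mul_self.1 (nonneg_iff_posSemidef.2 (hG i))
  have e : (piKron C)ᴴ = piKron fun i => (C i)ᴴ := by
    ext p q
    simp [piKron]
  have : piKron G = (piKron C)ᴴ * piKron C := by
    rw [e, piKron_mul]
    exact congrArg piKron (funext hC)
  rw [this]
  exact posSemidef_conjTranspose_mul_self _

end PiKron

section Product

variable {m : ℕ} {X E : Fin m → Type*}

/-- Regrouping of the registers by their index. -/
def regroup : ((∀ i, X i) × (∀ i, E i)) ≃ ∀ i, X i × E i where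
  toFun p i := (p.1 i, p.2 i)
  invFun f := (fun i => (f i).1, fun i => (f i).2)
  left_inv _ := rfl
  right_inv _ := rfl

theorem trace_submatrix_equiv {n n' : Type*} [Fintype n] [Fintype n'] (M : Matrix n n ℂ)
    (e : n' ≃ n) : (M.submatrix e e).trace = M.trace :=
  Equiv.sum_comp e fun k => M k k

theorem productState_eq (ρ : ∀ i, Matrix (X i × E i) (X i × E i) ℂ) :
    productState ρ = (piKron ρ).submatrix regroup regroup := rfl

variable [∀ i, Fintype (X i)] [∀ i, Fintype (E i)]

theorem trace_productState_mul (ρ G : ∀ i, Matrix (X i × E i) (X i × E i) ℂ) :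
    (productState ρ * productState G).trace = ∏ i, (ρ i * G i).trace := by
  rw [productState_eq, productState_eq, submatrix_mul_equiv, piKron_mul, trace_submatrix_equiv,
    trace_piKron]

theorem productState_posSemidef {ρ : ∀ i, Matrix (X i × E i) (X i × E i) ℂ}
    (hρ : ∀ i, (ρ i).PosSemidef) : (productState ρ).PosSemidef :=
  (piKron_posSemidef hρ).submatrix _

theorem trace_productState (ρ : ∀ i, Matrix (X i × E i) (X i × E i) ℂ) :
    (productState ρ).trace = ∏ i, (ρ i).trace := by
  rw [productState_eq, trace_submatrix_equiv, trace_piKron]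

end Product

theorem prod_eq_mul_mul_prod {m : ℕ} {i j : Fin m} (hij : i ≠ j) (f : Fin m → ℂ) :
    ∏ k, f k = f i * f j * ∏ k ∈ (Finset.univ.erase i).erase j, f k := by
  rw [← Finset.mul_prod_erase _ _ (Finset.mem_univ i),
    ← Finset.mul_prod_erase _ _ (Finset.mem_erase.2 ⟨hij.symm, Finset.mem_univ j⟩), mul_assoc]

/-! ### Operators on two of the registers -/

section Pair

variable {m : ℕ} {X E : Fin m → Type*} {i j : Fin m}

/-- Regrouping of the registers `Xᵢ Xⱼ E` into `Xᵢ Eᵢ`, `Xⱼ Eⱼ` and the other `E`-registers. -/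
def pairRegroup (X E : Fin m → Type*) (i j : Fin m) (p : (X i × X j) × (∀ k, E k)) :
    ((X i × E i) × (X j × E j)) × (∀ k : {k : Fin m // k ≠ i ∧ k ≠ j}, E k) :=
  (((p.1.1, p.2 i), (p.1.2, p.2 j)), fun k => p.2 k)

theorem pairRegroup_bijective (hij : i ≠ j) : Function.Bijective (pairRegroup X E i j) := by
  constructor
  · rintro ⟨⟨x, x'⟩, e⟩ ⟨⟨y, y'⟩, e'⟩ h
    simp only [pairRegroup, Prod.mk.injEq] at h
    obtain ⟨⟨⟨rfl, h1⟩, rfl, h2⟩, h3⟩ := h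
    refine Prod.ext rfl (funext fun k => ?_)
    by_cases hi : k = i
    · subst hi; exact h1
    by_cases hj : k = j
    · subst hj; exact h2
    exact congrFun h3 ⟨k, hi, hj⟩
  · rintro ⟨⟨⟨x, ei⟩, ⟨x', ej⟩⟩, e⟩
    refine ⟨((x, x'), fun k => if hi : k = i then hi ▸ ei else if hj : k = j then hj ▸ ej else
      e ⟨k, hi, hj⟩), ?_⟩
    simp only [pairRegroup, Prod.mk.injEq, true_and, dite_true]
    refine ⟨?_, ?_⟩
    · rw [dif_neg hij.symm]
    · ext ⟨k, hi, hj⟩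
      simp only at hi hj ⊢
      rw [dif_neg hi, dif_neg hj]

variable [∀ i, DecidableEq (E i)]

/-- The extension of an operator on `Xᵢ Eᵢ Xⱼ Eⱼ` to the registers `Xᵢ Xⱼ E`. -/
def pairLift (i j : Fin m) (C : Matrix ((X i × E i) × (X j × E j)) ((X i × E i) × (X j × E j)) ℂ) :
    Matrix ((X i × X j) × (∀ k, E k)) ((X i × X j) × (∀ k, E k)) ℂ :=
  (C ⊗ₖ (1 : Matrix (∀ k : {k : Fin m // k ≠ i ∧ k ≠ j}, E k)
    (∀ k : {k : Fin m // k ≠ i ∧ k ≠ j}, E k) ℂ)).submatrix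
    (pairRegroup X E i j) (pairRegroup X E i j)

theorem pairLift_one [∀ i, DecidableEq (X i)] (hij : i ≠ j) :
    pairLift i j (1 : Matrix ((X i × E i) × (X j × E j)) ((X i × E i) × (X j × E j)) ℂ) = 1 := by
  rw [pairLift, one_kronecker_one, submatrix_one _ (pairRegroup_bijective hij).1]

theorem traceLeft_pairLift [∀ i, Fintype (X i)] (A : Matrix (X i × E i) (X i × E i) ℂ)
    (B : Matrix (X j × E j) (X j × E j) ℂ) :
    traceLeft (pairLift i j (A ⊗ₖ B)) =
      ((traceLeft A ⊗ₖ traceLeft B) ⊗ₖ (1 : Matrix (∀ k : {k : Fin m // k ≠ i ∧ k ≠ j}, E k)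
        (∀ k : {k : Fin m // k ≠ i ∧ k ≠ j}, E k) ℂ)).submatrix
        (fun e => ((e i, e j), fun k => e k)) (fun e => ((e i, e j), fun k => e k)) := by
  ext e e'
  simp only [traceLeft, of_apply, pairLift, submatrix_apply, pairRegroup, kroneckerMap_apply,
    Fintype.sum_prod_type, Finset.sum_mul, Finset.mul_sum]
  exact Finset.sum_comm

variable [∀ i, Fintype (X i)] [∀ i, Fintype (E i)]

theorem pairLift_mul (hij : i ≠ j)
    (C D : Matrix ((X i × E i) × (X j × E j)) ((X i × E i) × (X j × E j)) ℂ) :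
    pairLift i j C * pairLift i j D = pairLift i j (C * D) := by
  have := submatrix_mul_equiv (C ⊗ₖ (1 : Matrix (∀ k : {k : Fin m // k ≠ i ∧ k ≠ j}, E k)
    (∀ k : {k : Fin m // k ≠ i ∧ k ≠ j}, E k) ℂ)) (D ⊗ₖ 1) (pairRegroup X E i j)
    (Equiv.ofBijective _ (pairRegroup_bijective hij)) (pairRegroup X E i j)
  rw [← mul_kronecker_mul, Matrix.mul_one] at this
  exact this

theorem pairLift_posSemidef
    {C : Matrix ((X i × E i) × (X j × E j)) ((X i × E i) × (X j × E j)) ℂ} (hC : C.PosSemidef) :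
    (pairLift i j C).PosSemidef :=
  (hC.kronecker PosSemidef.one).submatrix _

/-- Marginal bounds multiply because `μν - A ⊗ B = (μ - A) ⊗ ν + A ⊗ (ν - B)`, applied to the
marginals. -/
theorem sub_traceLeft_pairLift_posSemidef (hij : i ≠ j) {A : Matrix (X i × E i) (X i × E i) ℂ}
    {B : Matrix (X j × E j) (X j × E j) ℂ} {μ ν : ℝ} (hν : 0 ≤ ν) (hA : A.PosSemidef)
    (hAμ : ((μ : ℂ) • (1 : Matrix (E i) (E i) ℂ) - traceLeft A).PosSemidef)
    (hBν : ((ν : ℂ) • (1 : Matrix (E j) (E j) ℂ) - traceLeft B).PosSemidef) :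
    (((μ * ν : ℝ) : ℂ) • (1 : Matrix (∀ k, E k) (∀ k, E k) ℂ)
      - traceLeft (pairLift i j (A ⊗ₖ B))).PosSemidef := by
  have h1 := (hAμ.kronecker ((PosSemidef.one (n := E j) (R := ℂ)).smul
    (Complex.zero_le_real.2 hν))).add ((traceLeft_posSemidef hA).kronecker hBν)
  have h2 := (h1.kronecker (PosSemidef.one (n := ∀ k : {k : Fin m // k ≠ i ∧ k ≠ j}, E k)
    (R := ℂ))).submatrix (fun e : ∀ k, E k => ((e i, e j), fun k => e k))
  have h3 : ((μ : ℂ) • (1 : Matrix (E i) (E i) ℂ) - traceLeft A) ⊗ₖ ((ν : ℂ) • 1)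
      + traceLeft A ⊗ₖ ((ν : ℂ) • 1 - traceLeft B)
      = ((μ * ν : ℝ) : ℂ) • 1 - traceLeft A ⊗ₖ traceLeft B := by
    ext p q
    simp only [Matrix.add_apply, Matrix.sub_apply, kroneckerMap_apply, Matrix.smul_apply,
      smul_eq_mul, ← one_kronecker_one (α := ℂ) (m := E i) (n := E j), Complex.ofReal_mul]
    ring
  rw [h3] at h2
  rw [traceLeft_pairLift]
  have hinj : Function.Injective fun e : ∀ k, E k =>
      (((e i, e j), fun k => e k) : (E i × E j) × ∀ k : {k : Fin m // k ≠ i ∧ k ≠ j}, E k) := by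
    intro e e' h
    simp only [Prod.mk.injEq] at h
    obtain ⟨⟨h1, h2⟩, h3⟩ := h
    funext k
    by_cases hi : k = i
    · subst hi; exact h1
    by_cases hj : k = j
    · subst hj; exact h2
    exact congrFun h3 ⟨k, hi, hj⟩
  have h4 : ((((μ * ν : ℝ) : ℂ) • (1 : Matrix (E i × E j) (E i × E j) ℂ)
      - traceLeft A ⊗ₖ traceLeft B) ⊗ₖ (1 : Matrix (∀ k : {k : Fin m // k ≠ i ∧ k ≠ j}, E k)
        (∀ k : {k : Fin m // k ≠ i ∧ k ≠ j}, E k) ℂ)).submatrix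
        (fun e : ∀ k, E k => ((e i, e j), fun k => e k)) (fun e => ((e i, e j), fun k => e k))
      = ((μ * ν : ℝ) : ℂ) • (1 : Matrix (∀ k, E k) (∀ k, E k) ℂ)
        - ((traceLeft A ⊗ₖ traceLeft B) ⊗ₖ (1 : Matrix (∀ k : {k : Fin m // k ≠ i ∧ k ≠ j}, E k)
        (∀ k : {k : Fin m // k ≠ i ∧ k ≠ j}, E k) ℂ)).submatrix
        (fun e => ((e i, e j), fun k => e k)) (fun e => ((e i, e j), fun k => e k)) := by
    have h5 : (1 : Matrix ((E i × E j) × (∀ k : {k : Fin m // k ≠ i ∧ k ≠ j}, E k))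
        ((E i × E j) × (∀ k : {k : Fin m // k ≠ i ∧ k ≠ j}, E k)) ℂ) = 1 ⊗ₖ 1 :=
      one_kronecker_one.symm
    rw [← submatrix_one _ hinj, h5]
    ext p q
    simp only [Matrix.sub_apply, kroneckerMap_apply, Matrix.smul_apply, smul_eq_mul,
      submatrix_apply]
    ring
  rw [← h4]
  exact h2

variable [∀ i, DecidableEq (X i)]

theorem trace_pairState_mul_pairLift_kronecker (hij : i ≠ j)
    {ρ : ∀ k, Matrix (X k × E k) (X k × E k) ℂ} (hρ : ∀ k, (ρ k).trace = 1)
    (A : Matrix (X i × E i) (X i × E i) ℂ) (B : Matrix (X j × E j) (X j × E j) ℂ) :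
    (pairState (productState ρ) i j * pairLift i j (A ⊗ₖ B)).trace
      = (ρ i * A).trace * (ρ j * B).trace := by
  set G : ∀ k, Matrix (X k × E k) (X k × E k) ℂ :=
    Function.update (Function.update (fun k => 1) j B) i A with hG
  have hGi : G i = A := by simp [hG]
  have hGj : G j = B := by simp [hG, hij.symm]
  have hGk : ∀ k, k ≠ i → k ≠ j → G k = 1 := fun k h1 h2 => by simp [hG, h1, h2]
  have hlift : (of fun p q : (∀ k, X k) × (∀ k, E k) =>
      if (fun k : {k : Fin m // k ≠ i ∧ k ≠ j} => p.1 k) = (fun k : {k : Fin m // k ≠ i ∧ k ≠ j} => q.1 k) then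
        pairLift i j (A ⊗ₖ B) ((p.1 i, p.1 j), p.2) ((q.1 i, q.1 j), q.2) else 0)
      = productState G := by
    ext p q
    have hp : productState G p q = ∏ k, G k (p.1 k, p.2 k) (q.1 k, q.2 k) := rfl
    have hone : ∏ k ∈ (Finset.univ.erase i).erase j, G k (p.1 k, p.2 k) (q.1 k, q.2 k)
        = ∏ k ∈ (Finset.univ.erase i).erase j,
          if p.1 k = q.1 k ∧ p.2 k = q.2 k then (1 : ℂ) else 0 := by
      refine Finset.prod_congr rfl fun k hk => ?_
      simp only [Finset.mem_erase, Finset.mem_univ, and_true] at hk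
      rw [hGk k hk.2 hk.1, one_apply]
      simp only [Prod.mk.injEq]
    rw [hp, prod_eq_mul_mul_prod hij, hone, Finset.prod_ite_zero, hGi, hGj]
    simp only [of_apply, pairLift, submatrix_apply, pairRegroup, kroneckerMap_apply, one_apply,
      Finset.prod_const_one, funext_iff, Subtype.forall, Finset.mem_erase, Finset.mem_univ,
      and_true, mul_ite, mul_one, mul_zero]
    rw [← ite_and]
    refine if_congr ?_ rfl rfl
    constructor
    · rintro ⟨h1, h2⟩ k hk
      exact ⟨h1 k ⟨hk.2, hk.1⟩, h2 k ⟨hk.2, hk.1⟩⟩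
    · intro h
      exact ⟨fun k hk => (h k ⟨hk.2, hk.1⟩).1, fun k hk => (h k ⟨hk.2, hk.1⟩).2⟩
  rw [pairState, trace_partialTrace_mul, hlift, trace_productState_mul, prod_eq_mul_mul_prod hij,
    hGi, hGj, Finset.prod_eq_one, mul_one]
  intro k hk
  simp only [Finset.mem_erase, Finset.mem_univ, and_true] at hk
  rw [hGk k hk.2 hk.1, Matrix.mul_one, hρ]

theorem trace_pairState_mul_pairLift (hij : i ≠ j)
    {ρ : ∀ k, Matrix (X k × E k) (X k × E k) ℂ} (hρ : ∀ k, (ρ k).trace = 1)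
    (C : Matrix ((X i × E i) × (X j × E j)) ((X i × E i) × (X j × E j)) ℂ) :
    (pairState (productState ρ) i j * pairLift i j C).trace = ((ρ i ⊗ₖ ρ j) * C).trace := by
  induction C using Matrix.induction_on' with
  | h_zero => simp [pairLift]
  | h_add C D hC hD =>
    rw [Matrix.mul_add, trace_add, ← hC, ← hD, ← trace_add, ← Matrix.mul_add]
    simp only [pairLift, add_kronecker]
    rfl
  | h_std_basis p q x =>
    have : single p q x = single p.1 q.1 x ⊗ₖ single p.2 q.2 (1 : ℂ) := by
      rw [single_kronecker_single, mul_one]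
    rw [this, trace_pairState_mul_pairLift_kronecker hij hρ, ← mul_kronecker_mul, trace_kronecker]

theorem trace_mul_pairLift_le (hij : i ≠ j) {A : Matrix (X i × E i) (X i × E i) ℂ}
    {B : Matrix (X j × E j) (X j × E j) ℂ} {μ ν : ℝ} (hν : 0 ≤ ν) (hA : A.PosSemidef)
    (hB : B.PosSemidef)
    (hAμ : ((μ : ℂ) • (1 : Matrix (E i) (E i) ℂ) - traceLeft A).PosSemidef)
    (hBν : ((ν : ℂ) • (1 : Matrix (E j) (E j) ℂ) - traceLeft B).PosSemidef)
    {τ : Matrix ((X i × X j) × (∀ k, E k)) ((X i × X j) × (∀ k, E k)) ℂ}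
    {σ : Matrix (∀ k, E k) (∀ k, E k) ℂ} (hσ : σ.PosSemidef)
    (hτσ : ((1 : Matrix (X i × X j) (X i × X j) ℂ) ⊗ₖ σ - τ).PosSemidef) :
    (τ * pairLift i j (A ⊗ₖ B)).trace.re ≤ μ * ν * σ.trace.re := by
  have h1 := trace_mul_re_nonneg hτσ (pairLift_posSemidef (i := i) (j := j) (hA.kronecker hB))
  rw [Matrix.sub_mul, trace_sub, trace_mul_comm _ (pairLift i j (A ⊗ₖ B)),
    trace_mul_one_kronecker, Complex.sub_re] at h1
  have h2 := trace_mul_re_nonneg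
    (sub_traceLeft_pairLift_posSemidef hij hν hA hAμ hBν) hσ
  rw [Matrix.sub_mul, trace_sub, Matrix.smul_mul, Matrix.one_mul, trace_smul, smul_eq_mul,
    Complex.sub_re, Complex.re_ofReal_mul] at h2
  linarith

end Pair

/-! ### Multiplying two dual certificates -/

theorem fidelity_sq_le_of_mul_eq_one {n : Type*} [Fintype n] [DecidableEq n]
    {ρ τ G G' : Matrix n n ℂ} (hρ : ρ.PosSemidef) (hτ : τ.PosSemidef) (hG : Gᴴ = G)
    (hG' : G'ᴴ = G') (hGG : G * G' = 1) {t : ℝ} (ht : 0 < t)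
    (h1 : (ρ * (G * G)).trace.re ≤ t) (h2 : (τ * (G' * G')).trace.re ≤ 1) :
    fidelity ρ τ ^ 2 ≤ t := by
  -- Rescaling `G` by `c⁻¹` and `G'` by `c` balances the two terms of the arithmetic mean, each
  -- becoming at most `√t`.
  set c := √(√t) with hc
  have hc0 : 0 < c := Real.sqrt_pos.2 (Real.sqrt_pos.2 ht)
  have hcc : c * c = √t := Real.mul_self_sqrt (Real.sqrt_nonneg t)
  have htt : √t * √t = t := Real.mul_self_sqrt ht.le
  have hst : 0 < √t := Real.sqrt_pos.2 ht
  have key := fidelity_le_of_mul_eq_one hρ hτ (G := (c⁻¹ : ℝ) • G) (G' := c • G')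
    (by rw [conjTranspose_smul, hG]; simp) (by rw [conjTranspose_smul, hG']; simp)
    (by rw [smul_mul_smul_comm, hGG, inv_mul_cancel₀ hc0.ne', one_smul])
  rw [smul_mul_smul_comm, smul_mul_smul_comm, Matrix.mul_smul, Matrix.mul_smul, trace_smul,
    trace_smul, Complex.smul_re, Complex.smul_re, ← mul_inv, hcc, smul_eq_mul, smul_eq_mul] at key
  have h3 : (√t)⁻¹ * (ρ * (G * G)).trace.re ≤ √t := by
    rw [inv_mul_le_iff₀ hst, htt]
    exact h1
  have h4 : √t * (τ * (G' * G')).trace.re ≤ √t := mul_le_of_le_one_right hst.le h2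
  have h5 : fidelity ρ τ ≤ √t := by linarith
  calc fidelity ρ τ ^ 2 ≤ √t ^ 2 := pow_le_pow_left₀ (fidelity_nonneg ρ τ) h5 2
    _ = t := Real.sq_sqrt ht.le

theorem specOp_kronecker {n m : Type*} [Fintype n] [DecidableEq n] [Fintype m] [DecidableEq m]
    (U : Matrix n n ℂ) (V : Matrix m m ℂ) (g : n → ℝ) (h : m → ℝ) :
    specOp (U ⊗ₖ V) (fun k => g k.1 * h k.2) = specOp U g ⊗ₖ specOp V h := by
  simp only [specOp, conjTranspose_kronecker, mul_kronecker_mul, diagonal_kronecker_diagonal,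
    Complex.ofReal_mul]

/-- A dual certificate for the fidelity of `ρ` to operators of bounded conditional min-entropy. -/
structure DualCertificate {a b : Type*} [Fintype a] [DecidableEq a] [Fintype b] [DecidableEq b]
    (ρ : Matrix (a × b) (a × b) ℂ) (c h : ℝ) where
  /-- eigenvectors -/
  U : Matrix (a × b) (a × b) ℂ
  /-- eigenvalues -/
  w : a × b → ℝ
  /-- multiplier of the trace constraint -/
  s : ℝ
  /-- bound on the marginal -/
  μ : ℝ
  isometry : Uᴴ * U = 1
  coisometry : U * Uᴴ = 1
  w_nonneg : ∀ k, 0 ≤ w k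
  s_pos : 0 < s
  μ_pos : 0 < μ
  marginal_le : ((μ : ℂ) • (1 : Matrix b b ℂ) - traceLeft (specOp U w)).PosSemidef
  value_lt : ∑ k, ((Uᴴ * ρ * U) k k).re * (s + w k)⁻¹ + (s + c * μ) < 2 * h

section Weights

variable {n : Type*} [Fintype n] {ρ U : Matrix n n ℂ}

theorem weight_nonneg (hρ : ρ.PosSemidef) (k : n) : 0 ≤ ((Uᴴ * ρ * U) k k).re :=
  (Complex.nonneg_iff.1 (hρ.conjTranspose_mul_mul_same U).diag_nonneg).1

theorem weight_eq (hρ : ρ.PosSemidef) (k : n) :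
    (Uᴴ * ρ * U) k k = (((Uᴴ * ρ * U) k k).re : ℂ) :=
  Complex.ext rfl (by
    simpa using (Complex.nonneg_iff.1 (hρ.conjTranspose_mul_mul_same U).diag_nonneg).2.symm)

theorem sum_weight [DecidableEq n] (hρ : IsState ρ) (hU : U * Uᴴ = 1) : ∑ k, ((Uᴴ * ρ * U) k k).re = 1 := by
  have : (Uᴴ * ρ * U).trace = 1 := by
    rw [trace_mul_comm, ← Matrix.mul_assoc, hU, Matrix.one_mul, hρ.2]
  rw [← Complex.re_sum]
  change (Uᴴ * ρ * U).trace.re = 1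
  rw [this, Complex.one_re]

end Weights

section Pair

variable {m : ℕ} {X E : Fin m → Type*} {i j : Fin m}
  [∀ i, Fintype (X i)] [∀ i, DecidableEq (X i)] [∀ i, Fintype (E i)] [∀ i, DecidableEq (E i)]

/-- The left side is the product of `Tr ρ(s + W)⁻¹` and `s + cμ`; their sum is below `2h`, so the
product is below `h²`. The parameters `r = cμ / s` and `x = w / (cμ)` put it in the form of the
scalar inequality. -/
theorem DualCertificate.normalized {a b : Type*} [Fintype a] [DecidableEq a] [Fintype b]
    [DecidableEq b] {ρ : Matrix (a × b) (a × b) ℂ} {c h : ℝ} (D : DualCertificate ρ c h)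
    (hρ : IsState ρ) (hc : 0 < c) :
    (1 + c * D.μ / D.s) * ∑ k, ((D.Uᴴ * ρ * D.U) k k).re *
      (1 + c * D.μ / D.s * (D.w k / (c * D.μ)))⁻¹ < h ^ 2 := by
  have hs := D.s_pos
  have hμ := D.μ_pos
  have hcμ : 0 < c * D.μ := mul_pos hc hμ
  have e : (1 + c * D.μ / D.s) * ∑ k, ((D.Uᴴ * ρ * D.U) k k).re *
      (1 + c * D.μ / D.s * (D.w k / (c * D.μ)))⁻¹
      = (D.s + c * D.μ) * ∑ k, ((D.Uᴴ * ρ * D.U) k k).re * (D.s + D.w k)⁻¹ := by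
    rw [Finset.mul_sum, Finset.mul_sum]
    refine Finset.sum_congr rfl fun k _ => ?_
    have hw := D.w_nonneg k
    have h1 : 1 + c * D.μ / D.s * (D.w k / (c * D.μ)) = (D.s + D.w k) / D.s := by field_simp
    rw [h1]
    field_simp
  rw [e]
  have h0 : 0 ≤ ∑ k, ((D.Uᴴ * ρ * D.U) k k).re * (D.s + D.w k)⁻¹ :=
    Finset.sum_nonneg fun k _ => mul_nonneg (weight_nonneg hρ.1 k)
      (inv_nonneg.2 (add_nonneg hs.le (D.w_nonneg k)))
  have hv := D.value_lt
  set A := ∑ k, ((D.Uᴴ * ρ * D.U) k k).re * (D.s + D.w k)⁻¹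
  set N := D.s + c * D.μ
  have hN : 0 < N := add_pos hs hcμ
  nlinarith [sq_nonneg (A - N)]

/-- Two dual certificates bound the fidelity of a product state to operators whose conditional
min-entropy exceeds the sum of the entropies of the certificates. -/
theorem fidelity_pair_lt (hij : i ≠ j) {ρ : ∀ k, Matrix (X k × E k) (X k × E k) ℂ}
    (hρ : ∀ k, IsState (ρ k)) {h c c' d : ℝ} (hh : h ^ 2 ≤ 1) (hc : 0 < c) (hc' : 0 < c')
    (D : DualCertificate (ρ i) c h) (D' : DualCertificate (ρ j) c' h)
    (hpair : (pairState (productState ρ) i j).PosSemidef)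
    {τ : Matrix ((X i × X j) × (∀ k, E k)) ((X i × X j) × (∀ k, E k)) ℂ} (hτ : τ.PosSemidef)
    (hτ1 : τ.trace.re ≤ 1) {σ : Matrix (∀ k, E k) (∀ k, E k) ℂ} (hσ : σ.PosSemidef)
    (hτσ : ((1 : Matrix (X i × X j) (X i × X j) ℂ) ⊗ₖ σ - τ).PosSemidef)
    (hσd : σ.trace.re ≤ d) (hd : 3 * d ≤ c * c') :
    fidelity (pairState (productState ρ) i j) τ ^ 2 < 1 - (1 - h ^ 2) ^ 2 := by
  have hμ := D.μ_pos
  have hμ' := D'.μ_pos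
  set x : X i × E i → ℝ := fun k => D.w k / (c * D.μ) with hx
  set y : X j × E j → ℝ := fun k => D'.w k / (c' * D'.μ) with hy
  have hx0 : ∀ k, 0 ≤ x k := fun k => div_nonneg (D.w_nonneg k) (by positivity)
  have hy0 : ∀ k, 0 ≤ y k := fun k => div_nonneg (D'.w_nonneg k) (by positivity)
  have hn := D.normalized (hρ i) hc
  have hn' := D'.normalized (hρ j) hc'
  obtain ⟨R, hR, hRle⟩ := exists_average_inv_le (fun k => ((D.Uᴴ * ρ i * D.U) k k).re) x
    (fun k => ((D'.Uᴴ * ρ j * D'.U) k k).re) y (fun k => weight_nonneg (hρ i).1 k)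
    (fun k => weight_nonneg (hρ j).1 k) (sum_weight (hρ i) D.coisometry)
    (sum_weight (hρ j) D'.coisometry) hx0 hy0 (r := c * D.μ / D.s) (s := c' * D'.μ / D'.s)
    (div_pos (by positivity) D.s_pos) (div_pos (by positivity) D'.s_pos)
    (hn.le.trans hh) (hn'.le.trans hh)
  set f := (1 + c * D.μ / D.s) * ∑ k, ((D.Uᴴ * ρ i * D.U) k k).re *
      (1 + c * D.μ / D.s * x k)⁻¹
  set f' := (1 + c' * D'.μ / D'.s) * ∑ k, ((D'.Uᴴ * ρ j * D'.U) k k).re *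
      (1 + c' * D'.μ / D'.s * y k)⁻¹
  have hf : f < h ^ 2 := hn
  have hf' : f' < h ^ 2 := hn'
  -- Spectrum of the combined witness. The prefactor normalizes `Tr(τZ)` to at most one, using `3 *
  -- d ≤ c * c'`.
  set z : (X i × E i) × (X j × E j) → ℝ := fun k => (1 + 3 * R * (x k.1 * y k.2)) / (1 + R) with hz
  have hz0 : ∀ k, 0 < z k := fun k => by
    have := hx0 k.1
    have := hy0 k.2
    simp only [hz]
    positivity
  set V := D.U ⊗ₖ D'.U with hV
  have hVV : Vᴴ * V = 1 := by
    rw [hV, conjTranspose_kronecker, ← mul_kronecker_mul, D.isometry, D'.isometry,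
      one_kronecker_one]
  have hVV' : V * Vᴴ = 1 := by
    rw [hV, conjTranspose_kronecker, ← mul_kronecker_mul, D.coisometry, D'.coisometry,
      one_kronecker_one]
  set G := pairLift i j (specOp V fun k => √(z k)⁻¹) with hG
  set G' := pairLift i j (specOp V fun k => √(z k)) with hG'
  have hGG : G * G' = 1 := by
    rw [hG, hG', pairLift_mul hij, specOp_mul hVV, ← pairLift_one hij, ← specOp_one hVV']
    congr 2
    ext k
    rw [← Real.sqrt_mul (inv_nonneg.2 (hz0 k).le), inv_mul_cancel₀ (hz0 k).ne', Real.sqrt_one]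
  have hGh : Gᴴ = G :=
    (pairLift_posSemidef (specOp_posSemidef V fun k => Real.sqrt_nonneg _)).1
  have hGh' : G'ᴴ = G' :=
    (pairLift_posSemidef (specOp_posSemidef V fun k => Real.sqrt_nonneg _)).1
  have h1 : (pairState (productState ρ) i j * (G * G)).trace.re ≤ 1 - (1 - f) * (1 - f') := by
    rw [hG, pairLift_mul hij, specOp_mul hVV,
      trace_pairState_mul_pairLift hij (fun k => (hρ k).2), trace_mul_specOp]
    refine le_trans (le_of_eq ?_) hRle
    rw [Complex.re_sum, Fintype.sum_prod_type, Finset.mul_sum]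
    refine Finset.sum_congr rfl fun k _ => ?_
    rw [Finset.mul_sum]
    refine Finset.sum_congr rfl fun l _ => ?_
    rw [hV, conjTranspose_kronecker, ← mul_kronecker_mul, ← mul_kronecker_mul, kronecker_apply,
      weight_eq (hρ i).1, weight_eq (hρ j).1, Real.mul_self_sqrt (inv_nonneg.2 (hz0 _).le),
      ← Complex.ofReal_mul, ← Complex.ofReal_mul, Complex.ofReal_re]
    simp only [hz, inv_div, Complex.ofReal_re]
    ring
  have h2 : (τ * (G' * G')).trace.re ≤ 1 := by
    rw [hG', pairLift_mul hij, specOp_mul hVV]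
    have e : specOp V (fun k => √(z k) * √(z k)) = (((1 + R)⁻¹ : ℝ) : ℂ) • 1
        + ((3 * R / ((1 + R) * (c * D.μ) * (c' * D'.μ)) : ℝ) : ℂ) •
          (specOp D.U D.w ⊗ₖ specOp D'.U D'.w) := by
      rw [← specOp_one hVV', ← specOp_kronecker, ← specOp_const_mul, ← specOp_const_mul,
        ← specOp_add]
      congr 1
      ext k
      rw [Real.mul_self_sqrt (hz0 k).le]
      simp only [hz, hx, hy]
      field_simp
    have e2 : ∀ (a b : ℂ) (B : Matrix ((X i × E i) × (X j × E j)) ((X i × E i) × (X j × E j)) ℂ),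
        pairLift i j (a • 1 + b • B) = a • 1 + b • pairLift i j B := by
      intro a b B
      rw [← pairLift_one hij]
      ext p q
      simp only [pairLift, submatrix_apply, kroneckerMap_apply, Matrix.add_apply,
        Matrix.smul_apply, smul_eq_mul]
      ring
    rw [e, e2, Matrix.mul_add, Matrix.mul_smul, Matrix.mul_smul, Matrix.mul_one, trace_add,
      trace_smul, trace_smul, smul_eq_mul, smul_eq_mul, Complex.add_re, Complex.re_ofReal_mul,
      Complex.re_ofReal_mul]
    have h3 := trace_mul_pairLift_le hij hμ'.le (specOp_posSemidef D.U D.w_nonneg)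
      (specOp_posSemidef D'.U D'.w_nonneg) D.marginal_le D'.marginal_le hσ hτσ
    have h4 : 3 * R / ((1 + R) * (c * D.μ) * (c' * D'.μ)) *
        (τ * pairLift i j (specOp D.U D.w ⊗ₖ specOp D'.U D'.w)).trace.re ≤ R / (1 + R) := by
      calc _ ≤ 3 * R / ((1 + R) * (c * D.μ) * (c' * D'.μ)) * (D.μ * D'.μ * d) := by
            refine mul_le_mul_of_nonneg_left (h3.trans ?_) (by positivity)
            exact mul_le_mul_of_nonneg_left hσd (by positivity)
        _ = R / (1 + R) * (3 * d / (c * c')) := by field_simp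
        _ ≤ R / (1 + R) := mul_le_of_le_one_right (by positivity)
            ((div_le_one (by positivity)).2 hd)
    have h5 : (1 + R)⁻¹ * τ.trace.re ≤ (1 + R)⁻¹ := mul_le_of_le_one_right (by positivity) hτ1
    have h6 : (1 + R)⁻¹ + R / (1 + R) = 1 := by field_simp
    linarith
  have hlt : 1 - (1 - f) * (1 - f') < 1 - (1 - h ^ 2) ^ 2 := by nlinarith
  have hnn : 0 ≤ 1 - (1 - f) * (1 - f') := by
    refine le_trans ?_ h1
    refine trace_mul_re_nonneg hpair ?_
    have := posSemidef_conjTranspose_mul_self G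
    rwa [hGh] at this
  -- An intermediate `t` is strictly positive, as the fidelity bound requires, even if `1 - (1 - f)
  -- * (1 - f')` vanishes.
  obtain ⟨t, ht1, ht2⟩ := exists_between hlt
  exact (fidelity_sq_le_of_mul_eq_one hpair hτ hGh hGh' hGG (hnn.trans_lt ht1) (h1.trans ht1.le)
    h2).trans_lt ht2

end Pair

theorem partialTrace_posSemidef {n a b : Type*} [Fintype n] [Fintype a] [DecidableEq a]
    [Fintype b] [DecidableEq b] (keep : n → a) (discard : n → b) {M : Matrix n n ℂ}
    (hM : M.PosSemidef) : (partialTrace keep discard M).PosSemidef := by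
  refine posSemidef_of_re_trace_nonneg ?_ fun x => ?_
  · ext s t
    rw [conjTranspose_apply]
    simp only [partialTrace, of_apply, star_sum]
    rw [Finset.sum_comm]
    refine Finset.sum_congr rfl fun p _ => Finset.sum_congr rfl fun q _ => ?_
    rw [apply_ite star, star_zero, hM.1.apply]
    exact if_congr ⟨fun h => ⟨h.2.1, h.1, h.2.2.symm⟩, fun h => ⟨h.2.1, h.1, h.2.2.symm⟩⟩ rfl rfl
  · classical
    rw [trace_partialTrace_mul]
    refine trace_mul_re_nonneg hM ?_
    have := ((posSemidef_vecMulVec_self_star x).kronecker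
      (PosSemidef.one (n := b) (R := ℂ))).submatrix fun p => (keep p, discard p)
    have e : (of fun p q => if discard p = discard q then
        vecMulVec x (star x) (keep p) (keep q) else 0) = ((vecMulVec x (star x)) ⊗ₖ
        (1 : Matrix b b ℂ)).submatrix (fun p => (keep p, discard p))
          fun p => (keep p, discard p) := by
      ext p q
      simp [kroneckerMap_apply, one_apply]
    rw [e]
    exact this

/-! ### Isometric embeddings of registers -/

section Embed

variable {a b : Type*} [Fintype a] [DecidableEq b]

/-- The matrix of the linear map sending the basis vector `j` of the image of `ι` to its
preimage. -/
def coembedding {a b : Type*} [DecidableEq b] (ι : a → b) : Matrix a b ℂ := of fun i j => if ι i = j then 1 else 0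

/-- The transport of an operator along an inclusion of bases. -/
def embed (ι : a → b) (M : Matrix a a ℂ) : Matrix b b ℂ :=
  (coembedding ι)ᴴ * M * coembedding ι

theorem coembedding_mul_mul {a b : Type*} [Fintype b] [DecidableEq b] (ι : a → b) (L : Matrix b b ℂ) :
    coembedding ι * L * (coembedding ι)ᴴ = L.submatrix ι ι := by
  ext i j
  simp [coembedding, mul_apply, apply_ite]

theorem trace_embed_mul [Fintype b] (ι : a → b) (M : Matrix a a ℂ) (L : Matrix b b ℂ) :
    (embed ι M * L).trace = (M * L.submatrix ι ι).trace := by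
  rw [embed, ← coembedding_mul_mul, Matrix.mul_assoc, Matrix.mul_assoc, trace_mul_comm]
  simp only [Matrix.mul_assoc]

theorem trace_embed [Fintype b] [DecidableEq a] {ι : a → b} (hι : Function.Injective ι)
    (M : Matrix a a ℂ) : (embed ι M).trace = M.trace := by
  have := trace_embed_mul ι M 1
  rwa [Matrix.mul_one, submatrix_one _ hι, Matrix.mul_one] at this

theorem embed_posSemidef [Fintype b] (ι : a → b) {M : Matrix a a ℂ} (hM : M.PosSemidef) :
    (embed ι M).PosSemidef :=
  hM.conjTranspose_mul_mul_same _

theorem embed_apply [DecidableEq a] (ι : a → b) (M : Matrix a a ℂ) (p q : b) :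
    embed ι M p q = ∑ j, (∑ i, if ι i = p then M i j else 0) * if ι j = q then 1 else 0 := by
  simp [embed, coembedding, mul_apply, apply_ite]

theorem embed_apply_apply [DecidableEq a] {ι : a → b} (hι : Function.Injective ι)
    (M : Matrix a a ℂ) (i j : a) : embed ι M (ι i) (ι j) = M i j := by
  simp [embed_apply, hι.eq_iff]

theorem embed_apply_eq_zero [DecidableEq a] {ι : a → b} (M : Matrix a a ℂ) {p q : b}
    (h : (∀ i, ι i ≠ p) ∨ ∀ i, ι i ≠ q) : embed ι M p q = 0 := by
  rcases h with h | h <;> simp [embed_apply, h]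

theorem embed_one_kronecker {c : Type*} [Fintype c] [DecidableEq c] (ι : a → b)
    (ω : Matrix a a ℂ) :
    embed (fun p : c × a => (p.1, ι p.2)) ((1 : Matrix c c ℂ) ⊗ₖ ω) = 1 ⊗ₖ embed ι ω := by
  have : coembedding (fun p : c × a => (p.1, ι p.2)) = (1 : Matrix c c ℂ) ⊗ₖ coembedding ι := by
    ext p q
    simp only [coembedding, of_apply, kroneckerMap_apply, one_apply, Prod.ext_iff, ite_and,
      ite_mul, one_mul, zero_mul]
  rw [embed, this, conjTranspose_kronecker, ← mul_kronecker_mul, ← mul_kronecker_mul, embed]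
  simp

end Embed

/-! ### From entropies to operator inequalities and back -/

section Entropy

theorem one_sub_posSemidef {n : Type*} [Fintype n] [DecidableEq n] {τ : Matrix n n ℂ}
    (hτ : τ.PosSemidef) : ((τ.trace.re : ℂ) • 1 - τ).PosSemidef := by
  obtain ⟨U, w, hU, hU', hw, rfl⟩ := exists_specOp_of_posSemidef hτ
  have ht : (specOp U w).trace.re = ∑ i, w i := by
    have := trace_mul_specOp 1 U w
    rw [Matrix.one_mul] at this
    rw [this]
    simp [hU]
  have e : ((specOp U w).trace.re : ℂ) • 1 - specOp U w
      = specOp U (fun i => (∑ j, w j) * 1 + -1 * w i) := by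
    rw [specOp_add, specOp_const_mul, specOp_const_mul, specOp_one hU', ht]
    simp [sub_eq_add_neg]
  rw [e]
  refine specOp_posSemidef U fun i => ?_
  have := Finset.single_le_sum (fun j _ => hw j) (Finset.mem_univ i)
  linarith

variable {a b : Type*} [Fintype a] [DecidableEq a] [Fintype b]

theorem le_minEntropy {ρ : Matrix (a × b) (a × b) ℂ} {ω : Matrix b b ℂ} (hω : ω.PosSemidef)
    (h : ((1 : Matrix a a ℂ) ⊗ₖ ω - ρ).PosSemidef) {c : ℝ} (hωc : ω.trace.re ≤ c) :
    ((-Real.logb 2 c : ℝ) : EReal) ≤ minEntropy ρ := by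
  unfold minEntropy
  set I := sInf {t : ℝ | ∃ σ : Matrix b b ℂ, σ.PosSemidef ∧
    ((1 : Matrix a a ℂ) ⊗ₖ σ - ρ).PosSemidef ∧ t = σ.trace.re}
  have hI : I ≤ c := by
    have hb : BddBelow {t : ℝ | ∃ σ : Matrix b b ℂ, σ.PosSemidef ∧
        ((1 : Matrix a a ℂ) ⊗ₖ σ - ρ).PosSemidef ∧ t = σ.trace.re} := by
      refine ⟨0, ?_⟩
      rintro _ ⟨σ, hσ, -, rfl⟩
      exact (Complex.nonneg_iff.1 hσ.trace_nonneg).1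
    exact (csInf_le hb ⟨ω, hω, h, rfl⟩).trans hωc
  rw [EReal.coe_neg, EReal.neg_le_neg_iff]
  unfold log2
  split_ifs with h0
  · exact bot_le
  · rw [EReal.coe_le_coe_iff]
    exact Real.logb_le_logb_of_le one_lt_two (not_le.1 h0) hI

theorem exists_of_lt_minEntropy [DecidableEq b] {ρ : Matrix (a × b) (a × b) ℂ}
    (hρ : ρ.PosSemidef) {d : ℝ} (hd : 0 < d)
    (h : ((-Real.logb 2 d : ℝ) : EReal) < minEntropy ρ) :
    ∃ σ : Matrix b b ℂ, σ.PosSemidef ∧ ((1 : Matrix a a ℂ) ⊗ₖ σ - ρ).PosSemidef ∧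
      σ.trace.re ≤ d := by
  unfold minEntropy at h
  set s := {t : ℝ | ∃ σ : Matrix b b ℂ, σ.PosSemidef ∧
    ((1 : Matrix a a ℂ) ⊗ₖ σ - ρ).PosSemidef ∧ t = σ.trace.re} with hs
  have hne : s.Nonempty := by
    refine ⟨_, (ρ.trace.re : ℂ) • 1, PosSemidef.one.smul ?_, ?_, rfl⟩
    · exact Complex.zero_le_real.2 (Complex.nonneg_iff.1 hρ.trace_nonneg).1
    · rw [kronecker_smul, one_kronecker_one]
      exact one_sub_posSemidef hρ
  rw [EReal.coe_neg, EReal.neg_lt_neg_iff] at h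
  have hlt : sInf s < d := by
    unfold log2 at h
    split_ifs at h with h0
    · exact h0.trans_lt hd
    · rw [EReal.coe_lt_coe_iff] at h
      exact (Real.logb_lt_logb_iff one_lt_two (not_le.1 h0) hd).1 h
  obtain ⟨_, ⟨σ, h1, h2, rfl⟩, h3⟩ := exists_lt_of_csInf_lt hne hlt
  exact ⟨σ, h1, h2, h3.le⟩

/-- The strict inequality for `d` avoids having to attain either the supremum over the ball or the
infimum over `σ`. -/
theorem exists_of_le_smoothMinEntropy [DecidableEq b] {ρ : Matrix (a × b) (a × b) ℂ} {ε α d : ℝ}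
    (hd : 2 ^ (-α) < d) (h : (α : EReal) ≤ smoothMinEntropy ε ρ) :
    ∃ τ ∈ smoothBall ε ρ, ∃ σ : Matrix b b ℂ, σ.PosSemidef ∧
      ((1 : Matrix a a ℂ) ⊗ₖ σ - τ).PosSemidef ∧ σ.trace.re ≤ d := by
  have hd0 : 0 < d := (Real.rpow_pos_of_pos two_pos _).trans hd
  have h1 : ((-Real.logb 2 d : ℝ) : EReal) < smoothMinEntropy ε ρ := by
    refine lt_of_lt_of_le ?_ h
    rw [EReal.coe_lt_coe_iff, neg_lt, Real.lt_logb_iff_rpow_lt one_lt_two hd0]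
    exact hd
  unfold smoothMinEntropy at h1
  simp only [lt_iSup_iff] at h1
  obtain ⟨τ, hτ, hlt⟩ := h1
  exact ⟨τ, hτ, exists_of_lt_minEntropy hτ.1 hd0 hlt⟩

/-- A purification of `ρ` together with a nearby operator of large conditional min-entropy. -/
def HasSmoothing (ρ : Matrix (a × b) (a × b) ℂ) (ε c : ℝ) : Prop :=
  ∃ (R S : Matrix ((a × b) ⊕ (a × b)) (a × b) ℂ) (ω : Matrix b b ℂ), Rᴴ * R = ρ ∧
    (Sᴴ * S).trace.re ≤ 1 ∧ ω.PosSemidef ∧ ω.trace.re ≤ c ∧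
    ((1 : Matrix a a ℂ) ⊗ₖ ω - Sᴴ * S).PosSemidef ∧ √(1 - ε ^ 2) ≤ (Rᴴ * S).trace.re

theorem hasSmoothing_or_dualCertificate [DecidableEq b] {ρ : Matrix (a × b) (a × b) ℂ}
    (hρ : IsState ρ) {ε c : ℝ} (hε : 0 ≤ ε) (hc : 0 < c) :
    HasSmoothing ρ ε c ∨ ε < 1 ∧ Nonempty (DualCertificate ρ c (√(1 - ε ^ 2))) := by
  rcases lt_or_ge ε 1 with h1 | h1
  · have hh : 0 < √(1 - ε ^ 2) := Real.sqrt_pos.2 (by nlinarith)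
    refine (exists_purification_or_dual hρ hc hh).imp id fun h => ⟨h1, ?_⟩
    obtain ⟨U, w, s, μ, h1, h2, h3, h4, h5, h6, h7⟩ := h
    exact ⟨⟨U, w, s, μ, h1, h2, h3, h4, h5, h6, h7⟩⟩
  -- For `ε ≥ 1` the zero operator already lies in the ball, since the required overlap `√(1 - ε ^
  -- 2)` is zero.
  · left
    refine ⟨fromRows (CFC.sqrt ρ) 0, 0, 0, ?_, by simp, PosSemidef.zero, by simpa using hc.le,
      by simpa using PosSemidef.zero, ?_⟩
    · have hs : (CFC.sqrt ρ)ᴴ = CFC.sqrt ρ := (sqrt_posSemidef ρ).1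
      rw [conjTranspose_fromRows_eq_fromCols_conjTranspose, fromCols_mul_fromRows, hs,
        sqrt_mul_sqrt hρ.1]
      simp
    · rw [Real.sqrt_eq_zero_of_nonpos (by nlinarith)]
      simp

/-- The overlap of the two purifications, the traces and the domination by `1 ⊗ ω` all survive an
isometry on the conditioning system, so attaching the constant value of `V` costs nothing. -/
theorem le_smoothMinEntropy_embed {b' : Type*} [Fintype b'] [DecidableEq b'] [DecidableEq b]
    {ρ : Matrix (a × b) (a × b) ℂ} {ε c : ℝ} (hε : 0 ≤ ε)
    (h : HasSmoothing ρ ε c) {ι : b → b'} (hι : Function.Injective ι) :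
    ((-Real.logb 2 c : ℝ) : EReal) ≤
      smoothMinEntropy ε (embed (fun p : a × b => (p.1, ι p.2)) ρ) := by
  obtain ⟨R, S, ω, rfl, hS, hω, hωc, hle, hRS⟩ := h
  set κ : a × b → a × b' := fun p => (p.1, ι p.2)
  have hκ : Function.Injective κ := fun p q hpq => by
    simp only [κ, Prod.mk.injEq] at hpq
    exact Prod.ext hpq.1 (hι hpq.2)
  have hcoe : ∀ A B : Matrix ((a × b) ⊕ (a × b)) (a × b) ℂ,
      embed κ (Aᴴ * B) = (A * coembedding κ)ᴴ * (B * coembedding κ) := fun A B => by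
    rw [embed, conjTranspose_mul]
    simp only [Matrix.mul_assoc]
  have hball : embed κ (Sᴴ * S) ∈ smoothBall ε (embed κ (Rᴴ * R)) := by
    refine ⟨embed_posSemidef _ (posSemidef_conjTranspose_mul_self S), ?_, ?_⟩
    · have h1 := re_trace_le_fidelity (R * coembedding κ) (S * coembedding κ)
      rw [← hcoe, ← hcoe, ← hcoe, trace_embed hκ] at h1
      refine Real.sqrt_le_iff.2 ⟨hε, ?_⟩
      have h3 : 1 - ε ^ 2 ≤ fidelity (embed κ (Rᴴ * R)) (embed κ (Sᴴ * S)) ^ 2 :=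
        (Real.sqrt_le_left (fidelity_nonneg _ _)).1 (hRS.trans h1)
      linarith
    · rw [trace_embed hκ]
      exact hS
  refine le_trans ?_ (le_iSup₂ (f := fun τ (_ : τ ∈ smoothBall ε (embed κ (Rᴴ * R))) =>
    minEntropy τ) _ hball)
  refine le_minEntropy (embed_posSemidef ι hω) ?_ (by rwa [trace_embed hι])
  rw [← embed_one_kronecker]
  have := embed_posSemidef κ hle
  rw [embed, Matrix.mul_sub, Matrix.sub_mul] at this
  exact this

end Entropy

/-! ### Classical-quantum states and the constant register `V` -/

section CQ

variable {X E : Type*} [Fintype X] [DecidableEq X]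

theorem cq_apply (P : X → ℝ) (ρE : X → Matrix E E ℂ) (p q : X × E) :
    (∑ x, (P x : ℂ) • (Matrix.single x x (1 : ℂ) ⊗ₖ ρE x)) p q
      = if p.1 = q.1 then (P p.1 : ℂ) * ρE p.1 p.2 q.2 else 0 := by
  rw [Matrix.sum_apply]
  simp only [Matrix.smul_apply, kroneckerMap_apply, single_apply, smul_eq_mul, ite_mul, one_mul,
    zero_mul, mul_ite, mul_zero, ite_and]
  simp [Finset.sum_ite_eq']

theorem isState_of_isCQState [Fintype E] {ρ : Matrix (X × E) (X × E) ℂ} (h : IsCQState ρ) :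
    IsState ρ := by
  classical
  obtain ⟨P, ρE, hP, hP1, hρ, rfl⟩ := h
  refine ⟨posSemidef_sum _ fun x _ => ?_, ?_⟩
  · refine PosSemidef.smul (PosSemidef.kronecker ?_ (hρ x).1) (Complex.zero_le_real.2 (hP x))
    have : Matrix.single x x (1 : ℂ) = (Matrix.single x x (1 : ℂ))ᴴ * Matrix.single x x 1 := by
      simp
    rw [this]
    exact posSemidef_conjTranspose_mul_self _
  · rw [trace_sum]
    have : ∀ x, ((P x : ℂ) • (Matrix.single x x (1 : ℂ) ⊗ₖ ρE x)).trace = P x := fun x => by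
      rw [trace_smul, trace_kronecker, (hρ x).2]
      simp
    simp_rw [this]
    exact_mod_cast hP1

end CQ

section Registers

variable {m : ℕ} {X E : Fin m → Type*}

/-- The inclusion of the basis of `X E` into the one of `X V E` for the constant value `V = v₀`. -/
def withIndex (X E : Fin m → Type*) (v₀ : Fin m) (p : (∀ k, X k) × (∀ k, E k)) :
    ((∀ k, X k) × Fin m) × (∀ k, E k) :=
  ((p.1, v₀), p.2)

theorem withIndex_injective (v₀ : Fin m) : Function.Injective (withIndex X E v₀) := by
  rintro ⟨x, e⟩ ⟨x', e'⟩ h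
  simp only [withIndex, Prod.mk.injEq] at h
  exact Prod.ext h.1.1 h.2

variable [∀ i, Fintype (X i)] [∀ i, DecidableEq (X i)] [∀ i, Fintype (E i)]
  [∀ i, DecidableEq (E i)]

theorem isCQState_embed_productState (v₀ : Fin m) {ρ : ∀ i, Matrix (X i × E i) (X i × E i) ℂ}
    (hρ : ∀ i, IsCQState (ρ i)) : IsCQState (embed (withIndex X E v₀) (productState ρ)) := by
  choose P ρE hP hP1 hρE hρ using hρ
  refine ⟨fun y => if y.2 = v₀ then ∏ k, P k (y.1 k) else 0,
    fun y => piKron fun k => ρE k (y.1 k), fun y => ?_, ?_, fun y => ⟨?_, ?_⟩, ?_⟩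
  · simp only
    split_ifs
    · exact Finset.prod_nonneg fun k _ => hP k _
    · exact le_rfl
  · rw [Fintype.sum_prod_type]
    simp only [Finset.sum_ite_eq', Finset.mem_univ, if_true]
    have := Finset.prod_univ_sum (fun k => (Finset.univ : Finset (X k))) P
    rw [Fintype.piFinset_univ] at this
    rw [← this]
    exact Finset.prod_eq_one fun k _ => hP1 k
  · exact piKron_posSemidef fun k => (hρE k _).1
  · rw [trace_piKron]
    exact Finset.prod_eq_one fun k _ => (hρE k _).2
  · ext ⟨⟨x, v⟩, e⟩ ⟨⟨x', v'⟩, e'⟩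
    rw [cq_apply]
    simp only
    by_cases hv : v = v₀
    · subst hv
      by_cases hv' : v' = v
      · subst hv'
        have h := embed_apply_apply (withIndex_injective v') (productState ρ) (x, e) (x', e')
        simp only [withIndex] at h
        rw [h]
        have hk : ∀ k, ρ k (x k, e k) (x' k, e' k)
            = if x k = x' k then (P k (x k) : ℂ) * ρE k (x k) (e k) (e' k) else 0 := fun k => by
          rw [hρ k, cq_apply]
        simp only [productState, of_apply, hk, Finset.prod_ite_zero, Finset.mem_univ,
          true_imp_iff, Prod.mk.injEq, and_true, if_true, piKron, Finset.prod_mul_distrib,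
          funext_iff, Complex.ofReal_prod]
      · rw [if_neg (fun h => hv' (Prod.mk.inj h).2.symm)]
        refine embed_apply_eq_zero _ (Or.inr fun p hp => hv' ?_)
        simp only [withIndex, Prod.mk.injEq] at hp
        exact hp.1.2.symm
    · rw [embed_apply_eq_zero _ (Or.inl fun p hp => hv ?_), if_neg hv]
      · simp
      · simp only [withIndex, Prod.mk.injEq] at hp
        exact hp.1.2.symm

theorem forgetV_embed (v₀ : Fin m)
    (M : Matrix ((∀ k, X k) × (∀ k, E k)) ((∀ k, X k) × (∀ k, E k)) ℂ) :
    forgetV (embed (withIndex X E v₀) M) = M := by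
  rw [Matrix.ext_iff_trace_mul_right]
  intro N
  rw [forgetV, trace_partialTrace_mul, trace_embed_mul]
  congr 2
  ext p q
  simp [withIndex]

theorem embed_withIndex_eq_zero {v₀ : Fin m}
    (M : Matrix ((∀ k, X k) × (∀ k, E k)) ((∀ k, X k) × (∀ k, E k)) ℂ)
    {p q : ((∀ k, X k) × Fin m) × (∀ k, E k)} (h : p.1.2 ≠ v₀ ∨ q.1.2 ≠ v₀) :
    embed (withIndex X E v₀) M p q = 0 := by
  refine embed_apply_eq_zero _ (h.imp ?_ ?_) <;>
  · rintro h r rfl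
    exact h rfl

theorem condNe_embed {v v₀ : Fin m} (hv : v ≠ v₀)
    {M : Matrix ((∀ k, X k) × (∀ k, E k)) ((∀ k, X k) × (∀ k, E k)) ℂ} (hM : M.trace = 1) :
    condNe (embed (withIndex X E v₀) M) v = embed (withIndex X E v₀) M := by
  have hp : probNe (embed (withIndex X E v₀) M) v = 1 := by
    have : (embed (withIndex X E v₀) M).trace.re = 1 := by
      rw [trace_embed (withIndex_injective v₀), hM, Complex.one_re]
    rw [probNe, ← this, trace, Complex.re_sum]
    refine Finset.sum_congr rfl fun p _ => ?_
    split_ifs with h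
    · rfl
    · rw [diag_apply, embed_withIndex_eq_zero M (Or.inl (by rw [not_not.1 h]; exact hv))]
      simp
  ext p q
  simp only [condNe, of_apply, hp]
  split_ifs with h
  · simp
  · rw [not_and_or, not_not, not_not] at h
    rw [embed_withIndex_eq_zero M (h.imp (fun h => by rwa [h]) (fun h => by rwa [h]))]

theorem probNe_embed_self (v₀ : Fin m)
    (M : Matrix ((∀ k, X k) × (∀ k, E k)) ((∀ k, X k) × (∀ k, E k)) ℂ) :
    probNe (embed (withIndex X E v₀) M) v₀ = 0 := by
  refine Finset.sum_eq_zero fun p _ => ?_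
  split_ifs with h
  · rw [embed_withIndex_eq_zero M (Or.inl h), Complex.zero_re]
  · rfl

theorem localState_embed_productState (v v₀ : Fin m)
    {ρ : ∀ i, Matrix (X i × E i) (X i × E i) ℂ} (hρ : ∀ i, (ρ i).trace = 1) :
    localState (embed (withIndex X E v₀) (productState ρ)) v
      = embed (fun p : X v × E v => (p.1, (p.2, v₀))) (ρ v) := by
  rw [Matrix.ext_iff_trace_mul_right]
  intro N
  rw [localState, trace_partialTrace_mul, trace_embed_mul, trace_embed_mul]
  set N₀ := N.submatrix (fun p : X v × E v => (p.1, (p.2, v₀)))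
    (fun p : X v × E v => (p.1, (p.2, v₀)))
  set G : ∀ k, Matrix (X k × E k) (X k × E k) ℂ := Function.update (fun k => 1) v N₀ with hG
  have hGv : G v = N₀ := by simp [hG]
  have hGk : ∀ k, k ≠ v → G k = 1 := fun k hk => by simp [hG, hk]
  have hlift : (of fun p q : ((∀ k, X k) × Fin m) × (∀ k, E k) =>
      if ((fun k : {k : Fin m // k ≠ v} => p.1.1 k), (fun k : {k : Fin m // k ≠ v} => p.2 k))
        = ((fun k : {k : Fin m // k ≠ v} => q.1.1 k), (fun k : {k : Fin m // k ≠ v} => q.2 k))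
      then N (p.1.1 v, (p.2 v, p.1.2)) (q.1.1 v, (q.2 v, q.1.2)) else 0).submatrix
        (withIndex X E v₀) (withIndex X E v₀) = productState G := by
    ext p q
    have hp : productState G p q = ∏ k, G k (p.1 k, p.2 k) (q.1 k, q.2 k) := rfl
    have hone : ∏ k ∈ Finset.univ.erase v, G k (p.1 k, p.2 k) (q.1 k, q.2 k)
        = ∏ k ∈ Finset.univ.erase v, if p.1 k = q.1 k ∧ p.2 k = q.2 k then (1 : ℂ) else 0 := by
      refine Finset.prod_congr rfl fun k hk => ?_
      simp only [Finset.mem_erase, Finset.mem_univ, and_true] at hk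
      rw [hGk k hk, one_apply]
      simp only [Prod.mk.injEq]
    rw [hp, ← Finset.mul_prod_erase _ _ (Finset.mem_univ v), hone, Finset.prod_ite_zero, hGv]
    simp only [of_apply, submatrix_apply, withIndex, Finset.prod_const_one, funext_iff,
      Subtype.forall, Finset.mem_erase, Finset.mem_univ, and_true, mul_ite, mul_one, mul_zero,
      Prod.mk.injEq, N₀]
    refine if_congr ?_ rfl rfl
    exact ⟨fun h k hk => ⟨h.1 k hk, h.2 k hk⟩, fun h => ⟨fun k hk => (h k hk).1,
      fun k hk => (h k hk).2⟩⟩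
  rw [hlift, trace_productState_mul, ← Finset.mul_prod_erase _ _ (Finset.mem_univ v), hGv,
    Finset.prod_eq_one, mul_one]
  intro k hk
  rw [hGk k (Finset.ne_of_mem_erase hk), Matrix.mul_one, hρ]

/-- At most one pair of registers fails to have large smooth min-entropy. -/
theorem hasSmoothing_or_hasSmoothing (hm : 2 ≤ m) {ε α : ℝ} (hε : 0 ≤ ε)
    {ρ : ∀ i, Matrix (X i × E i) (X i × E i) ℂ} (hρ : ∀ i, IsState (ρ i)) {i j : Fin m}
    (hij : i ≠ j)
    (hα : (α : EReal) ≤ smoothMinEntropy (ε ^ 2) (pairState (productState ρ) i j)) :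
    HasSmoothing (ρ i) ε (m * 2 ^ (-(α / 2))) ∨ HasSmoothing (ρ j) ε (m * 2 ^ (-(α / 2))) := by
  have hpow : (0 : ℝ) < 2 ^ (-α) := Real.rpow_pos_of_pos two_pos _
  have hm' : (2 : ℝ) ≤ m := by exact_mod_cast hm
  have hc : (0 : ℝ) < m * 2 ^ (-(α / 2)) :=
    mul_pos (by linarith) (Real.rpow_pos_of_pos two_pos _)
  rcases hasSmoothing_or_dualCertificate (hρ i) hε hc with h | ⟨h1, ⟨D⟩⟩
  · exact Or.inl h
  rcases hasSmoothing_or_dualCertificate (hρ j) hε hc with h | ⟨-, ⟨D'⟩⟩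
  · exact Or.inr h
  exfalso
  -- The value `d = (4 / 3) * 2 ^ (-α)` exceeds `2 ^ (-α)`, while `3 * d = 4 * 2 ^ (-α)` is at most
  -- `c² = m² * 2 ^ (-α)` because `m ≥ 2`.
  obtain ⟨τ, hτ, σ, hσ, hτσ, hσd⟩ := exists_of_le_smoothMinEntropy (d := 4 / 3 * 2 ^ (-α))
    (by linarith) hα
  have hsq : √(1 - ε ^ 2) ^ 2 = 1 - ε ^ 2 := Real.sq_sqrt (by nlinarith)
  have hpair : (pairState (productState ρ) i j).PosSemidef :=
    partialTrace_posSemidef _ _ (productState_posSemidef fun k => (hρ k).1)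
  have hcc : 3 * (4 / 3 * 2 ^ (-α)) ≤ m * 2 ^ (-(α / 2)) * (m * 2 ^ (-(α / 2)) : ℝ) := by
    have : (2 : ℝ) ^ (-(α / 2)) * 2 ^ (-(α / 2)) = 2 ^ (-α) := by
      rw [← Real.rpow_add two_pos]
      ring_nf
    calc 3 * (4 / 3 * 2 ^ (-α)) = 2 * 2 * (2 : ℝ) ^ (-α) := by ring
      _ ≤ m * m * (2 : ℝ) ^ (-α) := by gcongr
      _ = _ := by rw [← this]; ring
  have h2 := fidelity_pair_lt hij hρ (by rw [hsq]; nlinarith) hc hc D D' hpair hτ.1 hτ.2.2 hσ hτσ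
    hσd hcc
  have h3 := (Real.sqrt_le_left (sq_nonneg ε)).1 hτ.2.1
  rw [hsq] at h2
  linarith [show (1 - (1 - ε ^ 2)) ^ 2 = (ε ^ 2) ^ 2 by ring]

end Registers

end QInfo

/-! ### The lemma -/

theorem mainTheorem11 {m : ℕ} (hm : 0 < m) {X E : Fin m → Type*}
    [∀ i, Fintype (X i)] [∀ i, DecidableEq (X i)]
    [∀ i, Fintype (E i)] [∀ i, DecidableEq (E i)]
    (ε : ℝ) (hε : 0 ≤ ε) (α : ℝ)
    (ρ : ∀ i, Matrix (X i × E i) (X i × E i) ℂ)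
    (hρ : ∀ i, QInfo.IsCQState (ρ i))
    (hα : ∀ i j : Fin m, i ≠ j →
      (α : EReal) ≤ QInfo.smoothMinEntropy (ε ^ 2)
        (QInfo.pairState (QInfo.productState ρ) i j)) :
    ∃ τ : Matrix (((∀ k, X k) × Fin m) × (∀ k, E k))
        (((∀ k, X k) × Fin m) × (∀ k, E k)) ℂ,
      QInfo.IsCQState τ ∧ QInfo.forgetV τ = QInfo.productState ρ ∧
      ∀ v : Fin m, 0 < QInfo.probNe τ v →
        ((α / 2 - Real.logb 2 m : ℝ) : EReal) ≤
          QInfo.smoothMinEntropy ε (QInfo.localState (QInfo.condNe τ v) v) := by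
  have hst : ∀ i, QInfo.IsState (ρ i) := fun i => QInfo.isState_of_isCQState (hρ i)
  have hm0 : (0 : ℝ) < m := by exact_mod_cast hm
  have hpow : (0 : ℝ) < 2 ^ (-(α / 2)) := Real.rpow_pos_of_pos two_pos _
  -- Otherwise every index leaves a failing one different from it; applying this twice gives two
  -- distinct failing indices, hence `m ≥ 2`. For `m = 1` the statement is vacuous.
  obtain ⟨v₀, hv₀⟩ : ∃ v₀ : Fin m, ∀ v, v ≠ v₀ →
      QInfo.HasSmoothing (ρ v) ε (m * 2 ^ (-(α / 2))) := by
    by_contra! h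
    obtain ⟨i, -, hi⟩ := h ⟨0, hm⟩
    obtain ⟨j, hji, hj⟩ := h i
    have hm2 : 2 ≤ m := by
      have := i.2
      have := j.2
      have := Fin.val_ne_of_ne hji
      omega
    exact (QInfo.hasSmoothing_or_hasSmoothing hm2 hε hst hji (hα j i hji)).elim hj hi
  refine ⟨QInfo.embed (QInfo.withIndex X E v₀) (QInfo.productState ρ),
    QInfo.isCQState_embed_productState v₀ hρ, QInfo.forgetV_embed v₀ _, fun v hv => ?_⟩
  have hne : v ≠ v₀ := by
    rintro rfl
    rw [QInfo.probNe_embed_self] at hv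
    exact lt_irrefl _ hv
  rw [QInfo.condNe_embed hne (by
      rw [QInfo.trace_productState]
      exact Finset.prod_eq_one fun k _ => (hst k).2),
    QInfo.localState_embed_productState v v₀ fun k => (hst k).2]
  have hlog : α / 2 - Real.logb 2 m = -Real.logb 2 (m * 2 ^ (-(α / 2))) := by
    rw [Real.logb_mul hm0.ne' hpow.ne', Real.logb_rpow two_pos (by norm_num)]
    ring
  rw [hlog]
  exact QInfo.le_smoothMinEntropy_embed hε (hv₀ v hne)
    (ι := fun e : E v => (e, v₀)) fun e e' h => (Prod.mk.inj h).1
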